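/- Let $(M^n,g)$ be a smooth $n$-dimensional Riemannian manifold (without boundary, Hausdorff, second countable) with Levi-Civita connection $\nabla$ and volume measure $dv_g$, let $u\in C^\infty(M)$, $V=e^u$, let $\lambda,\mu\in\mathbb R$ and put $\tau=(n+1)\lambda+\mu$. For the affine connection $D_XY=\nabla_XY+\lambda\,du(X)Y+\lambda\,du(Y)X+\mu\,g(X,Y)\nabla u$, the affine gradient and the affine Laplacian of a smooth function $f$ are $$\nabla^D f=V^{\mu-\lambda}\nabla f,\qquad \Delta^D f=V^{\mu-\lambda}\big[\Delta f+(2\mu+n\lambda)\langle\nabla u,\nabla f\rangle\big].$$ Let $\alpha\in\mathbb R$, $C>1$ and $C+\alpha-1>0$. Let $\rho$ be a nonnegative continuous function on $M$ and let $U=M\setminus\rho^{-1}\{0\}$. Suppose that, in the sense of distributions on $U$, $|\nabla^D\rho|=1$ and $\Delta^D\rho\ge\frac C\rho V^{\lambda-\mu}$. That is, $\rho$ has on $U$ a locally integrable distributional gradient $\nabla\rho$ with $|V^{\mu-\lambda}\nabla\rho|=1$ almost everywhere, and $$\int_M\rho\,(\Delta^D\psi)\,V^\tau\,dv_g\ \ge\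 \int_M\frac C\rho V^{\lambda-\mu}\,\psi\,V^\tau\,dv_g\qquad\text{for all } 0\le\psi\in C_0^\infty(U)$$ ($\Delta^D$ is symmetric with respect to $V^\tau dv_g$). Then for every $\phi\in C_0^\infty(M\setminus\rho^{-1}\{0\})$ both integrals below are finite and $$\int_M\rho^\alpha|\nabla^D\phi|^2V^{\tau+\lambda-\mu}\,dv_g\ \ge\ \Big(\frac{C+\alpha-1}2\Big)^2\int_M\rho^{\alpha-2}\phi^2V^{\tau+\lambda-\mu}\,dv_g .$$ -/

import Mathlib

open MeasureTheory Set Bundle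
open scoped Manifold ContDiff Bundle

noncomputable section

/-! Calculus on a smooth Riemannian manifold without boundary, of dimension `n`. -/

section Riemannian

variable {n : ℕ} {M : Type*} [TopologicalSpace M] [ChartedSpace (EuclideanSpace ℝ (Fin n)) M]
  [RiemannianBundle (fun x : M => TangentSpace (𝓡 n) x)]

/-- The coordinate vector field `∂ᵢ` of the chart `chartAt c`, at the point with coordinates `z`. -/
def coordVec (c : M) (z : EuclideanSpace ℝ (Fin n)) (i : Fin n) :
    TangentSpace (𝓡 n) ((chartAt (EuclideanSpace ℝ (Fin n)) c).symm z) :=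
  mfderiv (𝓡 n) (𝓡 n) (chartAt (EuclideanSpace ℝ (Fin n)) c).symm z (EuclideanSpace.single i 1)

/-- `√(det (gᵢⱼ))` in the chart `chartAt c`, where `gᵢⱼ = ⟨∂ᵢ, ∂ⱼ⟩`, at the point with
coordinates `z`. -/
def sqrtDetMetric (c : M) (z : EuclideanSpace ℝ (Fin n)) : ℝ :=
  Real.sqrt (Matrix.gram ℝ (coordVec c z)).det

/-- The Riemannian volume `√(det (gᵢⱼ)) dz` of the domain of the chart `chartAt c`, extended by
zero to a measure on `M`. -/
def chartVolume (n : ℕ) {M : Type*} [TopologicalSpace M]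
    [ChartedSpace (EuclideanSpace ℝ (Fin n)) M]
    [RiemannianBundle (fun x : M => TangentSpace (𝓡 n) x)] [MeasurableSpace M] (c : M) :
    Measure M :=
  (((volume : Measure (EuclideanSpace ℝ (Fin n))).restrict
      (chartAt (EuclideanSpace ℝ (Fin n)) c).target).withDensity
    (fun z => ENNReal.ofReal (sqrtDetMetric c z))).map
      (chartAt (EuclideanSpace ℝ (Fin n)) c).symm

/-- The Riemannian volume measure `dv_g`: the least measure on `M` that dominates all the chart
volumes. As these agree on overlaps of charts, it restricts to `√(det (gᵢⱼ)) dz` in each chart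
(when `M` is second countable). -/
def riemVolume (n : ℕ) (M : Type*) [TopologicalSpace M]
    [ChartedSpace (EuclideanSpace ℝ (Fin n)) M]
    [RiemannianBundle (fun x : M => TangentSpace (𝓡 n) x)] [MeasurableSpace M] : Measure M :=
  ⨆ c : M, chartVolume n c

/-- The Riemannian gradient `∇f`: the vector dual to the differential of `f` at `x`. -/
def riemGrad (n : ℕ) {M : Type*} [TopologicalSpace M]
    [ChartedSpace (EuclideanSpace ℝ (Fin n)) M]
    [RiemannianBundle (fun x : M => TangentSpace (𝓡 n) x)] (f : M → ℝ) (x : M) :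
    TangentSpace (𝓡 n) x :=
  haveI : FiniteDimensional ℝ (TangentSpace (𝓡 n) x) :=
    inferInstanceAs (FiniteDimensional ℝ (EuclideanSpace ℝ (Fin n)))
  haveI : CompleteSpace (TangentSpace (𝓡 n) x) := FiniteDimensional.complete ℝ _
  (InnerProductSpace.toDual ℝ (TangentSpace (𝓡 n) x)).symm (mfderiv (𝓡 n) 𝓘(ℝ, ℝ) f x)

/-- The Riemannian divergence `div X = (1/√g) ∑ᵢ ∂ᵢ (√g Xⁱ)`, `g = det (gᵢⱼ)`, of a vector field,
computed at `x` in the chart `chartAt x`. -/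
def riemDiv (X : (x : M) → TangentSpace (𝓡 n) x) (x : M) : ℝ :=
  (sqrtDetMetric x (chartAt (EuclideanSpace ℝ (Fin n)) x x))⁻¹ *
    ∑ i : Fin n, fderiv ℝ
      (fun z : EuclideanSpace ℝ (Fin n) =>
        sqrtDetMetric x z *
          EuclideanSpace.proj (𝕜 := ℝ) i
            (mfderiv (𝓡 n) (𝓡 n) (chartAt (EuclideanSpace ℝ (Fin n)) x)
              ((chartAt (EuclideanSpace ℝ (Fin n)) x).symm z)
              (X ((chartAt (EuclideanSpace ℝ (Fin n)) x).symm z))))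
      (chartAt (EuclideanSpace ℝ (Fin n)) x x) (EuclideanSpace.single i 1)

/-- The Laplace-Beltrami operator `Δf = div ∇f`. -/
def riemLaplacian (n : ℕ) {M : Type*} [TopologicalSpace M]
    [ChartedSpace (EuclideanSpace ℝ (Fin n)) M]
    [RiemannianBundle (fun x : M => TangentSpace (𝓡 n) x)] (f : M → ℝ) (x : M) : ℝ :=
  riemDiv (riemGrad n f) x

/-- The vector field `G` is the gradient of `ρ` in the sense of distributions on the open set `U`:
in each chart, the `i`-th distributional derivative of `ρ` is the locally integrable function
`⟨G, ∂ᵢ⟩`. -/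
def IsWeakGradOn (U : Set M) (ρ : M → ℝ) (G : (x : M) → TangentSpace (𝓡 n) x) : Prop :=
  ∀ (c : M) (i : Fin n),
    LocallyIntegrableOn
      (fun z => inner ℝ (G ((chartAt (EuclideanSpace ℝ (Fin n)) c).symm z)) (coordVec c z i))
      ((chartAt (EuclideanSpace ℝ (Fin n)) c).target ∩
        (chartAt (EuclideanSpace ℝ (Fin n)) c).symm ⁻¹' U) volume ∧
    ∀ η : EuclideanSpace ℝ (Fin n) → ℝ, ContDiff ℝ ∞ η → HasCompactSupport η →
      tsupport η ⊆ (chartAt (EuclideanSpace ℝ (Fin n)) c).target ∩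
        (chartAt (EuclideanSpace ℝ (Fin n)) c).symm ⁻¹' U →
      ∫ z, ρ ((chartAt (EuclideanSpace ℝ (Fin n)) c).symm z) *
          fderiv ℝ η z (EuclideanSpace.single i 1) =
        -∫ z, inner ℝ (G ((chartAt (EuclideanSpace ℝ (Fin n)) c).symm z)) (coordVec c z i) * η z

/-! The affine connection `D_X Y = ∇_X Y + λ du(X) Y + λ du(Y) X + μ g(X, Y) ∇u`, with `V = exp u`,
enters through its gradient and its Laplacian. -/

/-- `V ^ (μ - λ) • X`, where `V = exp u`: for `X` the gradient of a function (possibly in the sense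
of distributions), this is the affine gradient of that function. -/
def affineScale (lam mu : ℝ) (u : M → ℝ) (X : (x : M) → TangentSpace (𝓡 n) x) (x : M) :
    TangentSpace (𝓡 n) x :=
  (Real.exp (u x) ^ (mu - lam)) • X x

/-- The affine gradient `∇ᴰ f = V ^ (μ - λ) ∇f`. -/
def affineGrad (n : ℕ) {M : Type*} [TopologicalSpace M]
    [ChartedSpace (EuclideanSpace ℝ (Fin n)) M]
    [RiemannianBundle (fun x : M => TangentSpace (𝓡 n) x)]
    (lam mu : ℝ) (u f : M → ℝ) (x : M) : TangentSpace (𝓡 n) x :=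
  affineScale lam mu u (riemGrad n f) x

/-- The affine Laplacian `Δᴰ f = V ^ (μ - λ) (Δf + (2μ + nλ) ⟨∇u, ∇f⟩)`. -/
def affineLaplacian (n : ℕ) {M : Type*} [TopologicalSpace M]
    [ChartedSpace (EuclideanSpace ℝ (Fin n)) M]
    [RiemannianBundle (fun x : M => TangentSpace (𝓡 n) x)]
    (lam mu : ℝ) (u f : M → ℝ) (x : M) : ℝ :=
  Real.exp (u x) ^ (mu - lam) *
    (riemLaplacian n f x + (2 * mu + n * lam) * inner ℝ (riemGrad n u x) (riemGrad n f x))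

/-- `|∇ᴰ ρ| = 1` on `U` in the sense of distributions. -/
def WeakAffineGradNormEqOneOn (n : ℕ) {M : Type*} [TopologicalSpace M]
    [ChartedSpace (EuclideanSpace ℝ (Fin n)) M]
    [RiemannianBundle (fun x : M => TangentSpace (𝓡 n) x)] [MeasurableSpace M]
    (lam mu : ℝ) (u : M → ℝ) (U : Set M) (ρ : M → ℝ) : Prop :=
  ∃ G : (x : M) → TangentSpace (𝓡 n) x, IsWeakGradOn U ρ G ∧
    ∀ᵐ x ∂(riemVolume n M).restrict U, ‖affineScale lam mu u G x‖ = 1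

/-- `Δᴰ ρ ≥ f` on `U` in the sense of distributions: with `τ = (n + 1) λ + μ`, for which `Δᴰ` is
symmetric with respect to `V ^ τ dv_g`, one has `∫ ρ Δᴰψ V ^ τ dv_g ≥ ∫ f ψ V ^ τ dv_g` for all
nonnegative `ψ ∈ C₀^∞(U)`. -/
def WeakAffineLaplacianGeOn (n : ℕ) {M : Type*} [TopologicalSpace M]
    [ChartedSpace (EuclideanSpace ℝ (Fin n)) M]
    [RiemannianBundle (fun x : M => TangentSpace (𝓡 n) x)] [MeasurableSpace M]
    (lam mu : ℝ) (u : M → ℝ) (U : Set M) (ρ f : M → ℝ) : Prop :=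
  ∀ ψ : M → ℝ, ContMDiff (𝓡 n) 𝓘(ℝ, ℝ) ∞ ψ → HasCompactSupport ψ → tsupport ψ ⊆ U →
    (∀ x, 0 ≤ ψ x) →
    ∫ x, f x * ψ x * Real.exp (u x) ^ ((n + 1) * lam + mu) ∂(riemVolume n M) ≤
      ∫ x, ρ x * affineLaplacian n lam mu u ψ x *
        Real.exp (u x) ^ ((n + 1) * lam + mu) ∂(riemVolume n M)

end Riemannian

end

/-! ### Euclidean calculus -/

section EuclideanCalculus

variable {n : ℕ}

local notation "𝔼" => EuclideanSpace ℝ (Fin n)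

/-! Multiplied by `V ^ τ`, the affine Laplacian has divergence form, `V ^ τ Δᴰψ = div (V ^ (2μ + nλ)
∇ψ)`. If `G` is the weak gradient of `ρ`, the hypothesis on `Δᴰρ` therefore says that `∫ (C/ρ) V ^
(λ - μ) ψ V ^ τ ≤ -∫ V ^ (2μ + nλ) ⟨∇ψ, G⟩` for `ψ ≥ 0`. Insert `ψ = ρ ^ (α - 1) φ²`. Since `|G|² =
V ^ (2(λ - μ))`, differentiating the power of `ρ` produces `(α - 1) ρ ^ (α - 2) φ² V ^ ((n + 2)λ)`,
which joins the left side. With `A = C + α - 1` this gives `A ∫ ρ ^ (α - 2) φ² V ^ ((n + 2)λ) ≤ -∫ ρ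
^ (α - 1) V ^ (2μ + nλ) 2φ ⟨∇φ, G⟩`. Cauchy–Schwarz and a weighted Young inequality bound the right
side by `A/2` times the integral on the left plus `2/A` times the energy of `φ`; absorbing yields
the constant `(A/2)²`. Note that `τ + λ - μ = (n + 2)λ`.

The difficulty is that `ρ ^ (α - 1) φ²` is not smooth. A partition of unity localizes to one chart.
There `|G| = V ^ (λ - μ)` makes the weak derivatives of `ρ` locally bounded, so its mollifications
are smooth, stay in a compact subinterval of `(0, ∞)`, have uniformly bounded derivatives, and
converge together with these almost everywhere (`exists_contDiff_tendsto_of_weak_deriv_on`).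
Dominated convergence then justifies the formal test function (`integral_le_neg_integral_inner`).

Working in charts rests on two invariance facts: the divergence is the same in every chart, by the
Piola identity (`riemDiv_eq_in_chart`), and the volume restricts to `√(det g) dz` in every chart, by
change of variables (`riemVolume_restrict_source`). With them, integration by parts against `G`
reduces to the Euclidean definition of weak derivative (`integral_mul_affineLaplacian`). -/

theorem contDiff_of_eq_zero_off {F : Type*} [NormedAddCommGroup F] [NormedSpace ℝ F]
    {f : 𝔼 → F} {K T : Set 𝔼} {m : WithTop ℕ∞} (hK : IsClosed K) (hT : IsOpen T) (hKT : K ⊆ T)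
    (hf : ContDiffOn ℝ m f T) (h0 : ∀ z, z ∉ K → f z = 0) : ContDiff ℝ m f := by
  rw [contDiff_iff_contDiffAt]
  intro z
  by_cases hz : z ∈ K
  · exact hf.contDiffAt (hT.mem_nhds (hKT hz))
  · refine (contDiffAt_const (c := (0 : F))).congr_of_eventuallyEq ?_
    filter_upwards [hK.isOpen_compl.mem_nhds hz] with y hy using h0 y hy

theorem ContDiffOn.matrix_det {ι : Type*} [Fintype ι] [DecidableEq ι] {g : 𝔼 → Matrix ι ι ℝ}
    {s : Set 𝔼} {m : WithTop ℕ∞} (hg : ∀ i j, ContDiffOn ℝ m (fun z => g z i j) s) :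
    ContDiffOn ℝ m (fun z => (g z).det) s := by
  simp only [Matrix.det_apply]
  refine ContDiffOn.sum fun σ _ => ContDiffOn.const_smul _ ?_
  exact contDiffOn_prod fun i _ => hg _ _

theorem ContDiffOn.matrix_inv {ι : Type*} [Fintype ι] [DecidableEq ι] {g : 𝔼 → Matrix ι ι ℝ}
    {s : Set 𝔼} {m : WithTop ℕ∞} (hg : ∀ i j, ContDiffOn ℝ m (fun z => g z i j) s)
    (hdet : ∀ z ∈ s, (g z).det ≠ 0) (i j : ι) :
    ContDiffOn ℝ m (fun z => (g z)⁻¹ i j) s := by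
  simp only [Matrix.inv_def, Matrix.smul_apply, Ring.inverse_eq_inv', smul_eq_mul,
    Matrix.adjugate_apply]
  refine ((ContDiffOn.matrix_det hg).inv hdet).mul (ContDiffOn.matrix_det fun k l => ?_)
  by_cases hk : k = j
  · subst hk
    simp only [Matrix.updateRow_self]
    exact contDiffOn_const
  · simp only [Matrix.updateRow_ne hk]
    exact hg _ _

theorem trace_eq_sum_apply_single (L : 𝔼 →ₗ[ℝ] 𝔼) :
    LinearMap.trace ℝ 𝔼 L = ∑ i, L (EuclideanSpace.single i 1) i := by
  rw [LinearMap.trace_eq_sum_inner L (EuclideanSpace.basisFun (Fin n) ℝ)]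
  refine Finset.sum_congr rfl fun i _ => ?_
  simp [EuclideanSpace.basisFun_apply, EuclideanSpace.inner_single_left]

/-- Jacobi's formula for the derivative of the determinant, at the identity. -/
theorem hasFDerivAt_det_of_eq_id {B : 𝔼 → 𝔼 →L[ℝ] 𝔼} {B' : 𝔼 →L[ℝ] 𝔼 →L[ℝ] 𝔼} {z : 𝔼}
    (hB : HasFDerivAt B B' z) (hz : B z = ContinuousLinearMap.id ℝ 𝔼) :
    HasFDerivAt (fun y => (B y).det)
      (∑ i, (EuclideanSpace.proj (𝕜 := ℝ) i).comp
        ((ContinuousLinearMap.apply ℝ 𝔼 (EuclideanSpace.single i (1 : ℝ))).comp B')) z := by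
  classical
  let ent : Fin n → Fin n → 𝔼 →L[ℝ] ℝ := fun i j => (EuclideanSpace.proj (𝕜 := ℝ) i).comp
        ((ContinuousLinearMap.apply ℝ 𝔼 (EuclideanSpace.single j (1 : ℝ))).comp B')
  have hent : ∀ i j, HasFDerivAt (fun y => B y (EuclideanSpace.single j 1) i) (ent i j) z := by
    intro i j
    exact (EuclideanSpace.proj (𝕜 := ℝ) i).hasFDerivAt.comp z
      ((ContinuousLinearMap.apply ℝ 𝔼 (EuclideanSpace.single j (1 : ℝ))).hasFDerivAt.comp z hB)
  have hval : ∀ i j, B z (EuclideanSpace.single j 1) i = if i = j then 1 else 0 := by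
    intro i j
    rw [hz]
    simp
  have hdet : (fun y => (B y).det) = fun y => ∑ σ : Equiv.Perm (Fin n),
      ((Equiv.Perm.sign σ : ℤ) : ℝ) * ∏ i, B y (EuclideanSpace.single i 1) (σ i) := by
    funext y
    rw [ContinuousLinearMap.det, ← LinearMap.det_toMatrix (EuclideanSpace.basisFun (Fin n) ℝ).toBasis,
      Matrix.det_apply']
    refine Finset.sum_congr rfl fun σ _ => ?_
    congr 1
  rw [hdet]
  have key := HasFDerivAt.fun_sum (u := Finset.univ) fun (σ : Equiv.Perm (Fin n)) _ =>
    (HasFDerivAt.finsetProd (u := Finset.univ) (fun i _ => hent (σ i) i)).const_mul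
      ((Equiv.Perm.sign σ : ℤ) : ℝ)
  refine key.congr_fderiv ?_
  rw [Finset.sum_eq_single 1]
  · simp only [Equiv.Perm.sign_one, Units.val_one, Int.cast_one, one_smul, Equiv.Perm.one_apply]
    refine Finset.sum_congr rfl fun i _ => ?_
    rw [Finset.prod_congr rfl fun j _ => hval j j]
    simp [ent]
  · intro σ _ hσ
    rw [Finset.sum_eq_zero, smul_zero]
    intro i _
    -- A permutation other than the identity moves at least two points, so besides the
    -- differentiated factor another off-diagonal factor remains, and it vanishes at `z`.
    have : ∃ j, j ≠ i ∧ σ j ≠ j := by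
      by_contra! hcon
      refine hσ (Equiv.ext fun j => ?_)
      by_cases hj : j = i
      · subst hj
        by_contra hne
        have := hcon (σ j) hne
        exact hne (σ.injective this)
      · exact hcon j hj
    obtain ⟨j, hji, hj⟩ := this
    rw [Finset.prod_eq_zero (Finset.mem_erase.2 ⟨hji, Finset.mem_univ j⟩) (by rw [hval, if_neg hj]),
      zero_smul]
  · simp

/-- The Piola identity: the divergence is equivariant under local diffeomorphisms, once the vector
fields are multiplied by a volume density. -/
theorem trace_fderiv_of_pullback {T W Y : 𝔼 → 𝔼} {z : 𝔼} {W' Y' : 𝔼 →L[ℝ] 𝔼}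
    (hT : ContDiffAt ℝ 2 T z) (A : 𝔼 ≃L[ℝ] 𝔼) (hA : fderiv ℝ T z = A)
    (hW : HasFDerivAt W W' z) (hY : HasFDerivAt Y Y' (T z))
    (h : ∀ᶠ y in nhds z, fderiv ℝ T y (W y) = (fderiv ℝ T y).det • Y (T y)) :
    LinearMap.trace ℝ 𝔼 (W' : 𝔼 →ₗ[ℝ] 𝔼) =
      (A : 𝔼 →L[ℝ] 𝔼).det * LinearMap.trace ℝ 𝔼 (Y' : 𝔼 →ₗ[ℝ] 𝔼) := by
  have hT1 : HasFDerivAt T (A : 𝔼 →L[ℝ] 𝔼) z := by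
    rw [← hA]
    exact (hT.differentiableAt (by norm_num)).hasFDerivAt
  have hT2 : HasFDerivAt (fderiv ℝ T) (fderiv ℝ (fderiv ℝ T) z) z :=
    ((hT.fderiv_right (m := 1) (by norm_num)).differentiableAt (by norm_num)).hasFDerivAt
  have hsymm : ∀ v w, fderiv ℝ (fderiv ℝ T) z v w = fderiv ℝ (fderiv ℝ T) z w v := by
    intro v w
    exact (hT.isSymmSndFDerivAt (by simp)) v w
  let Ai : 𝔼 →L[ℝ] 𝔼 := (A.symm : 𝔼 →L[ℝ] 𝔼)
  -- Composing with `A⁻¹` normalizes the derivative to the identity at `z`, where Jacobi's formula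
  -- is simply a trace.
  let B : 𝔼 → 𝔼 →L[ℝ] 𝔼 := fun y => Ai.comp (fderiv ℝ T y)
  let B' : 𝔼 →L[ℝ] 𝔼 →L[ℝ] 𝔼 := (ContinuousLinearMap.compL ℝ 𝔼 𝔼 𝔼 Ai).comp
    (fderiv ℝ (fderiv ℝ T) z)
  have hB : HasFDerivAt B B' z :=
    (ContinuousLinearMap.compL ℝ 𝔼 𝔼 𝔼 Ai).hasFDerivAt.comp z hT2
  have hBz : B z = ContinuousLinearMap.id ℝ 𝔼 := by
    ext1 v
    simp [B, Ai, hA]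
  have hBsymm : ∀ v w, B' v w = B' w v := by
    intro v w
    simp [B', hsymm v w]
  have hdetB := hasFDerivAt_det_of_eq_id hB hBz
  set δ' : 𝔼 →L[ℝ] ℝ := ∑ i, (EuclideanSpace.proj (𝕜 := ℝ) i).comp
        ((ContinuousLinearMap.apply ℝ 𝔼 (EuclideanSpace.single i (1 : ℝ))).comp B') with hδ'
  let c : ℝ := (A : 𝔼 →L[ℝ] 𝔼).det
  have hY1 : HasFDerivAt (fun y => c • Ai (Y (T y)))
      (c • Ai.comp (Y'.comp (A : 𝔼 →L[ℝ] 𝔼))) z :=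
    ((Ai.hasFDerivAt.comp z (hY.comp z hT1))).const_smul c
  have hR := hdetB.smul hY1
  have hL := hB.clm_apply hW
  have hev : (fun y => B y (W y)) =ᶠ[nhds z] fun y => (B y).det • (c • Ai (Y (T y))) := by
    filter_upwards [h] with y hy
    have hd : (fderiv ℝ T y).det = c * (B y).det := by
      have : fderiv ℝ T y = (A : 𝔼 →L[ℝ] 𝔼).comp (B y) := by
        ext1 v
        simp [B, Ai]
      conv_lhs => rw [this]
      simp only [ContinuousLinearMap.det, c, ContinuousLinearMap.toLinearMap_comp]
      exact LinearMap.det_comp _ _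
    simp only [B, ContinuousLinearMap.comp_apply]
    rw [hy, hd, map_smul, smul_smul, mul_comm]
  have heq : _ = _ := (hR.congr_of_eventuallyEq hev).unique hL
  have hWz : W z = c • Ai (Y (T z)) := by
    have := hev.self_of_nhds
    simp only [hBz] at this
    simpa [ContinuousLinearMap.det] using this
  -- Take traces of the two expressions for the derivative. By symmetry of the second derivative,
  -- the trace of `v ↦ B' v (W z)` is `δ' (W z)`, which is also the trace of the rank-one map `v ↦
  -- δ' v • W z` on the other side. These terms cancel, and a conjugation of `Y'` by `A` remains.
  have htr := congrArg (fun L : 𝔼 →L[ℝ] 𝔼 => LinearMap.trace ℝ 𝔼 (L : 𝔼 →ₗ[ℝ] 𝔼)) heq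
  simp only [trace_eq_sum_apply_single] at htr
  have hsum1 : ∑ i, (B' (EuclideanSpace.single i 1) (W z)) i = δ' (W z) := by
    simp only [hδ', sum_apply]
    refine Finset.sum_congr rfl fun i _ => ?_
    rw [hBsymm]
    rfl
  have hsum2 : ∑ i, δ' (EuclideanSpace.single i 1) * W z i = δ' (W z) := by
    have hexp : W z = ∑ i, W z i • EuclideanSpace.single i (1 : ℝ) := by
      have := (EuclideanSpace.basisFun (Fin n) ℝ).sum_repr (W z)
      simpa [EuclideanSpace.basisFun_apply] using this.symm
    conv_rhs => rw [hexp, map_sum]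
    refine Finset.sum_congr rfl fun i _ => ?_
    rw [map_smul, smul_eq_mul, mul_comm]
  have hdet1 : (B z).det = 1 := by rw [hBz]; simp [ContinuousLinearMap.det]
  have hconj : LinearMap.trace ℝ 𝔼 ((Ai.comp (Y'.comp (A : 𝔼 →L[ℝ] 𝔼)) : 𝔼 →L[ℝ] 𝔼) : 𝔼 →ₗ[ℝ] 𝔼)
      = LinearMap.trace ℝ 𝔼 (Y' : 𝔼 →ₗ[ℝ] 𝔼) := by
    rw [show ((Ai.comp (Y'.comp (A : 𝔼 →L[ℝ] 𝔼)) : 𝔼 →L[ℝ] 𝔼) : 𝔼 →ₗ[ℝ] 𝔼) =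
      (Ai : 𝔼 →ₗ[ℝ] 𝔼) * ((Y' : 𝔼 →ₗ[ℝ] 𝔼) * ((A : 𝔼 →L[ℝ] 𝔼) : 𝔼 →ₗ[ℝ] 𝔼)) from rfl,
      LinearMap.trace_mul_comm, mul_assoc]
    congr 1
    ext v
    simp [Ai]
  rw [← hconj, trace_eq_sum_apply_single, trace_eq_sum_apply_single]
  rw [hBz] at hdet1
  simp [hBz, Finset.sum_add_distrib, ← hWz, hsum1, hsum2, hdet1] at htr
  simp only [Finset.mul_sum]
  exact htr.symm

end EuclideanCalculus

/-! ### Mollification of functions with bounded weak derivatives -/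

section Mollification

variable {n : ℕ}

local notation "𝔼" => EuclideanSpace ℝ (Fin n)

open Filter Topology in
/-- A continuous function with bounded weak derivatives is approximated by smooth functions whose
derivatives satisfy the same bound and converge almost everywhere. -/
theorem exists_contDiff_tendsto_of_weak_deriv {f : 𝔼 → ℝ} (hf : Continuous f) {δ D L : ℝ}
    (hδ : ∀ z, δ ≤ f z) (hD : ∀ z, f z ≤ D) {P : Fin n → 𝔼 → ℝ}
    (hP : ∀ i, AEStronglyMeasurable (P i) volume) (hPL : ∀ i, ∀ᵐ z, |P i z| ≤ L)
    (hweak : ∀ i, ∀ η : 𝔼 → ℝ, ContDiff ℝ ∞ η → HasCompactSupport η →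
      ∫ z, f z * fderiv ℝ η z (EuclideanSpace.single i 1) = -∫ z, P i z * η z) :
    ∃ r : ℕ → 𝔼 → ℝ, (∀ k, ContDiff ℝ ∞ (r k)) ∧ (∀ k z, δ ≤ r k z) ∧ (∀ k z, r k z ≤ D) ∧
      (∀ z, Tendsto (fun k => r k z) atTop (𝓝 (f z))) ∧
      (∀ k i z, |fderiv ℝ (r k) z (EuclideanSpace.single i 1)| ≤ L) ∧
      ∀ i, ∀ᵐ z, Tendsto (fun k => fderiv ℝ (r k) z (EuclideanSpace.single i 1)) atTop
        (𝓝 (P i z)) := by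
  let φ : ℕ → ContDiffBump (0 : 𝔼) := fun k =>
    ⟨1 / ((k : ℝ) + 1), 2 * (1 / ((k : ℝ) + 1)), by positivity, by
      have : 0 < 1 / ((k : ℝ) + 1) := by positivity
      linarith⟩
  have hφ0 : Tendsto (fun k => (φ k).rOut) atTop (𝓝 0) := by
    simpa [φ] using (tendsto_one_div_add_atTop_nhds_zero_nat (𝕜 := ℝ)).const_mul 2
  -- The bounded ratio of outer to inner radius is what Lebesgue differentiation needs for almost
  -- everywhere convergence of the mollified derivatives.
  have hφK : ∀ᶠ k in atTop, (φ k).rOut ≤ 2 * (φ k).rIn := Eventually.of_forall fun k => le_rfl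
  let m : ℕ → 𝔼 → ℝ := fun k => (φ k).normed volume
  have hm_smooth : ∀ k, ContDiff ℝ ∞ (m k) := fun k => (φ k).contDiff_normed
  have hm_supp : ∀ k, HasCompactSupport (m k) := fun k => (φ k).hasCompactSupport_normed
  have hm_nonneg : ∀ k z, 0 ≤ m k z := fun k => (φ k).nonneg_normed
  have hm_int : ∀ k, ∫ z, m k z = 1 := fun k => (φ k).integral_normed
  have hm_integrable : ∀ k, Integrable (m k) := fun k =>
    (hm_smooth k).continuous.integrable_of_hasCompactSupport (hm_supp k)
  have hPloc : ∀ i, LocallyIntegrable (P i) volume := fun i =>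
    (locallyIntegrable_const L).mono (hP i) (by
      filter_upwards [hPL i] with z hz
      simpa using hz.trans (le_abs_self L))
  let r : ℕ → 𝔼 → ℝ := fun k =>
    convolution (m k) f (ContinuousLinearMap.lsmul ℝ ℝ) volume
  have hr : ∀ k z, r k z = ∫ t, m k t * f (z - t) := fun k z => rfl
  have hr_int : ∀ k z, Integrable fun t => m k t * f (z - t) := fun k z =>
    ((hm_smooth k).continuous.mul (hf.comp (continuous_const.sub continuous_id))
      ).integrable_of_hasCompactSupport (hm_supp k).mul_right
  have hder : ∀ k i z, fderiv ℝ (r k) z (EuclideanSpace.single i 1) =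
      convolution (m k) (P i) (ContinuousLinearMap.lsmul ℝ ℝ) volume z := by
    intro k i z
    have h1 := (hm_supp k).hasFDerivAt_convolution_left (ContinuousLinearMap.lsmul ℝ ℝ)
      ((hm_smooth k).of_le (by simp)) (hf.locallyIntegrable (μ := volume)) z
    rw [h1.fderiv, convolution_def, ContinuousLinearMap.integral_apply]
    swap
    · refine (HasCompactSupport.convolutionExists_left (μ := volume) _
        ((hm_supp k).fderiv (𝕜 := ℝ)) ?_ hf.locallyIntegrable) z
      exact (hm_smooth k).continuous_fderiv (by simp)
    have hη : ContDiff ℝ ∞ fun t => m k (z - t) :=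
      (hm_smooth k).comp (contDiff_const.sub contDiff_id)
    have hηs : HasCompactSupport fun t => m k (z - t) :=
      (hm_supp k).comp_homeomorph (Homeomorph.subLeft z)
    have hηd : ∀ t, fderiv ℝ (fun t => m k (z - t)) t (EuclideanSpace.single i 1) =
        -fderiv ℝ (m k) (z - t) (EuclideanSpace.single i 1) := by
      intro t
      have h2 : HasFDerivAt (fun t : 𝔼 => z - t) (-ContinuousLinearMap.id ℝ 𝔼) t :=
        (hasFDerivAt_id t).const_sub z
      have h3 := ((hm_smooth k).differentiable (by simp) (z - t)).hasFDerivAt.comp t h2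
      rw [show (fun t => m k (z - t)) = m k ∘ fun t => z - t from rfl, h3.fderiv]
      simp
    -- The reflected and translated kernel is the test function: the derivative of the mollification
    -- is the mollification of the weak derivative. All bounds then follow since the kernel is
    -- nonnegative with integral one.
    have h4 := hweak i _ hη hηs
    simp only [hηd, mul_neg, integral_neg, neg_inj] at h4
    rw [convolution_eq_swap]
    simp only [ContinuousLinearMap.lsmul_apply, smul_eq_mul]
    have h5 : ∫ t, m k (z - t) * P i t = ∫ t, P i t * m k (z - t) :=
      integral_congr_ae (Eventually.of_forall fun t => mul_comm _ _)
    rw [h5, ← h4, ← integral_sub_left_eq_self _ volume z]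
    refine integral_congr_ae (Eventually.of_forall fun t => ?_)
    simp only [sub_sub_cancel, ContinuousLinearMap.precompL_apply, ContinuousLinearMap.lsmul_apply,
      smul_eq_mul]
    exact mul_comm _ _
  refine ⟨r, fun k => ?_, fun k z => ?_, fun k z => ?_, fun z => ?_, fun k i z => ?_, fun i => ?_⟩
  · exact (hm_supp k).contDiff_convolution_left _ (hm_smooth k) hf.locallyIntegrable
  · have : ∫ t, m k t * δ ≤ r k z := integral_mono ((hm_integrable k).mul_const δ) (hr_int k z)
      fun t => mul_le_mul_of_nonneg_left (hδ _) (hm_nonneg k t)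
    rwa [integral_mul_const, hm_int, one_mul] at this
  · have : r k z ≤ ∫ t, m k t * D := integral_mono (hr_int k z) ((hm_integrable k).mul_const D)
      fun t => mul_le_mul_of_nonneg_left (hD _) (hm_nonneg k t)
    rwa [integral_mul_const, hm_int, one_mul] at this
  · exact ContDiffBump.convolution_tendsto_right_of_continuous hφ0 hf z
  · rw [hder, convolution_eq_swap, ← Real.norm_eq_abs]
    have hint : Integrable fun t => m k (z - t) * L :=
      ((hm_integrable k).comp_sub_left z).mul_const L
    refine (norm_integral_le_of_norm_le hint ?_).trans_eq ?_
    · filter_upwards [hPL i] with t ht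
      simp only [ContinuousLinearMap.lsmul_apply, smul_eq_mul, norm_mul, Real.norm_eq_abs,
        abs_of_nonneg (hm_nonneg k _)]
      exact mul_le_mul_of_nonneg_left ht (hm_nonneg k _)
    · rw [integral_mul_const, integral_sub_left_eq_self (m k) volume z, hm_int, one_mul]
  · filter_upwards [ContDiffBump.ae_convolution_tendsto_right_of_locallyIntegrable hφ0 hφK
      (hPloc i)] with z hz
    simpa only [hder] using hz

end Mollification

/-! ### Metric, gradient and components of vectors in a chart -/

section ChartGeometry

variable {n : ℕ} {M : Type*} [TopologicalSpace M] [ChartedSpace (EuclideanSpace ℝ (Fin n)) M]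

local notation "𝔼" => EuclideanSpace ℝ (Fin n)

/-- The components of a tangent vector in the chart `chartAt c`. -/
noncomputable def chartCoord (c : M) {x : M} (v : TangentSpace (𝓡 n) x) : 𝔼 :=
  mfderiv (𝓡 n) (𝓡 n) (chartAt 𝔼 c) x v

theorem coordVec_sum_eq {c : M} {z : 𝔼} (a : 𝔼) :
    ∑ i, a i • coordVec c z i =
      mfderiv (𝓡 n) (𝓡 n) (chartAt 𝔼 c).symm z a := by
  have hexp : a = ∑ i, a i • EuclideanSpace.single i (1 : ℝ) := by
    have := (EuclideanSpace.basisFun (Fin n) ℝ).sum_repr a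
    simpa [EuclideanSpace.basisFun_apply] using this.symm
  conv_rhs => rw [hexp]
  exact ((map_sum (mfderiv (𝓡 n) (𝓡 n) (chartAt 𝔼 c).symm z) _ _).trans
    (Finset.sum_congr rfl fun i _ => map_smul _ _ _)).symm

theorem inner_riemGrad [RiemannianBundle (fun x : M => TangentSpace (𝓡 n) x)] (f : M → ℝ) (x : M)
    (v : TangentSpace (𝓡 n) x) :
    inner ℝ (riemGrad n f x) v = mfderiv (𝓡 n) 𝓘(ℝ, ℝ) f x v := by
  have : FiniteDimensional ℝ (TangentSpace (𝓡 n) x) :=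
    inferInstanceAs (FiniteDimensional ℝ (EuclideanSpace ℝ (Fin n)))
  have : CompleteSpace (TangentSpace (𝓡 n) x) := FiniteDimensional.complete ℝ _
  exact InnerProductSpace.toDual_symm_apply

variable [IsManifold (𝓡 n) ∞ M]

theorem mdifferentiable_chartAt (c : M) :
    (chartAt 𝔼 c).MDifferentiable (𝓡 n) (𝓡 n) :=
  have : IsManifold (𝓡 n) 1 M := .of_le (n := ∞) (by simp)
  mdifferentiable_chart c

/-- The coordinate field is the tangent map of the inverse chart applied to a constant field;
smoothness of the Gram matrix follows from this. -/
theorem contMDiffOn_coordVec (c : M) (i : Fin n) :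
    ContMDiffOn (𝓡 n) (𝓡 n).tangent ∞
      (fun z => (⟨(chartAt 𝔼 c).symm z, coordVec c z i⟩ : TangentBundle (𝓡 n) M))
      (chartAt 𝔼 c).target := by
  have h1 : ContMDiffOn (𝓡 n) (𝓡 n) ∞ (chartAt 𝔼 c).symm (chartAt 𝔼 c).target :=
    contMDiffOn_chart_symm
  have h2 := h1.contMDiffOn_tangentMapWithin (m := ∞) (by simp)
    (chartAt 𝔼 c).open_target.uniqueMDiffOn
  have h3 : ContMDiff (𝓡 n) (𝓡 n).tangent ∞
      (fun z : 𝔼 => (⟨z, EuclideanSpace.single i (1 : ℝ)⟩ : TangentBundle (𝓡 n) 𝔼)) :=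
    contMDiff_vectorSpace_iff_contDiff.2 contDiff_const
  refine (h2.comp h3.contMDiffOn fun z hz => hz).congr fun z hz => ?_
  simp only [Function.comp_apply, tangentMapWithin, coordVec]
  rw [mfderivWithin_of_isOpen (chartAt 𝔼 c).open_target hz]

theorem contDiffOn_comp_chartAt_symm {f : M → ℝ} (hf : ContMDiff (𝓡 n) 𝓘(ℝ, ℝ) ∞ f) (c : M) :
    ContDiffOn ℝ ∞ (f ∘ (chartAt 𝔼 c).symm) (chartAt 𝔼 c).target := by
  rw [← contMDiffOn_iff_contDiffOn]
  exact hf.comp_contMDiffOn contMDiffOn_chart_symm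

theorem chartCoord_coordVec {c : M} {z : 𝔼} (hz : z ∈ (chartAt 𝔼 c).target) (i : Fin n) :
    chartCoord c (coordVec c z i) = EuclideanSpace.single i 1 :=
  DFunLike.congr_fun ((mdifferentiable_chartAt c).comp_symm_deriv hz) (EuclideanSpace.single i 1)

theorem sum_chartCoord_smul_coordVec {c : M} {z : 𝔼} (hz : z ∈ (chartAt 𝔼 c).target)
    (v : TangentSpace (𝓡 n) ((chartAt 𝔼 c).symm z)) :
    ∑ i, chartCoord c v i • coordVec c z i = v := by
  rw [coordVec_sum_eq]
  have h := (mdifferentiable_chartAt c).symm_comp_deriv ((chartAt 𝔼 c).map_target hz)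
  rw [(chartAt 𝔼 c).right_inv hz] at h
  exact DFunLike.congr_fun h v

theorem linearIndependent_coordVec {c : M} {z : 𝔼} (hz : z ∈ (chartAt 𝔼 c).target) :
    LinearIndependent ℝ (coordVec c z) := by
  rw [Fintype.linearIndependent_iff]
  intro a ha i
  have h1 : mfderiv (𝓡 n) (𝓡 n) (chartAt 𝔼 c).symm z (WithLp.toLp 2 a : 𝔼) = 0 := by
    rw [← coordVec_sum_eq]
    exact ha
  have h2 := DFunLike.congr_fun ((mdifferentiable_chartAt c).comp_symm_deriv hz)
    (WithLp.toLp 2 a : 𝔼)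
  have h3 : (WithLp.toLp 2 a : 𝔼) = 0 := by
    refine h2.symm.trans ?_
    refine (congrArg (mfderiv (𝓡 n) (𝓡 n) (chartAt 𝔼 c) ((chartAt 𝔼 c).symm z)) h1).trans ?_
    exact map_zero _
  exact congrFun (congrArg WithLp.ofLp h3) i

variable [RiemannianBundle (fun x : M => TangentSpace (𝓡 n) x)]

theorem posDef_gram_coordVec {c : M} {z : 𝔼} (hz : z ∈ (chartAt 𝔼 c).target) :
    (Matrix.gram ℝ (coordVec c z)).PosDef :=
  Matrix.posDef_gram_of_linearIndependent (linearIndependent_coordVec hz)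

theorem det_gram_pos {c : M} {z : 𝔼} (hz : z ∈ (chartAt 𝔼 c).target) :
    0 < (Matrix.gram ℝ (coordVec c z)).det :=
  (posDef_gram_coordVec hz).det_pos

theorem sqrtDetMetric_pos {c : M} {z : 𝔼} (hz : z ∈ (chartAt 𝔼 c).target) :
    0 < sqrtDetMetric c z :=
  Real.sqrt_pos.2 (det_gram_pos hz)

/-- Pairing covariant with contravariant components keeps the Gram matrix out of the formula. This
suits weak gradients, which are given by their covariant components. -/
theorem inner_eq_sum_chartCoord {c : M} {z : 𝔼} (hz : z ∈ (chartAt 𝔼 c).target)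
    (v w : TangentSpace (𝓡 n) ((chartAt 𝔼 c).symm z)) :
    inner ℝ v w = ∑ i, inner ℝ v (coordVec c z i) * chartCoord c w i := by
  conv_lhs => rw [← sum_chartCoord_smul_coordVec hz w]
  rw [inner_sum]
  refine Finset.sum_congr rfl fun i _ => ?_
  rw [real_inner_smul_right, mul_comm]

/-- The covariant components are the Gram matrix applied to the contravariant ones; invert.
Smoothness and integrability pass in this way from `⟨v, ∂ⱼ⟩` to the chart components. -/
theorem chartCoord_eq_sum {c : M} {z : 𝔼} (hz : z ∈ (chartAt 𝔼 c).target)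
    (v : TangentSpace (𝓡 n) ((chartAt 𝔼 c).symm z)) (i : Fin n) :
    chartCoord c v i =
      ∑ j, (Matrix.gram ℝ (coordVec c z))⁻¹ i j * inner ℝ v (coordVec c z j) := by
  have h1 : (fun j => inner ℝ v (coordVec c z j)) =
      (Matrix.gram ℝ (coordVec c z)).mulVec fun i => chartCoord c v i := by
    funext j
    rw [real_inner_comm, inner_eq_sum_chartCoord hz]
    rfl
  have h2 := congrArg ((Matrix.gram ℝ (coordVec c z))⁻¹).mulVec h1
  rw [Matrix.mulVec_mulVec, Matrix.nonsing_inv_mul _ (det_gram_pos hz).ne'.isUnit,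
    Matrix.one_mulVec] at h2
  exact (congrFun h2 i).symm

theorem inner_riemGrad_coordVec {c : M} {z : 𝔼} (hz : z ∈ (chartAt 𝔼 c).target) {f : M → ℝ}
    (hf : MDifferentiableAt (𝓡 n) 𝓘(ℝ, ℝ) f ((chartAt 𝔼 c).symm z)) (i : Fin n) :
    inner ℝ (riemGrad n f ((chartAt 𝔼 c).symm z)) (coordVec c z i) =
      fderiv ℝ (f ∘ (chartAt 𝔼 c).symm) z (EuclideanSpace.single i 1) := by
  rw [inner_riemGrad, ← mfderiv_eq_fderiv,
    mfderiv_comp z hf ((mdifferentiable_chartAt c).mdifferentiableAt_symm hz)]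
  rfl

theorem contDiffOn_inner_riemGrad_coordVec {f : M → ℝ} (hf : ContMDiff (𝓡 n) 𝓘(ℝ, ℝ) ∞ f) (c : M)
    (i : Fin n) :
    ContDiffOn ℝ ∞ (fun z => inner ℝ (riemGrad n f ((chartAt 𝔼 c).symm z)) (coordVec c z i))
      (chartAt 𝔼 c).target := by
  have h := (contDiffOn_comp_chartAt_symm hf c).fderiv_of_isOpen (chartAt 𝔼 c).open_target
    (m := ∞) (by simp)
  refine (h.clm_apply (contDiffOn_const (c := EuclideanSpace.single i (1 : ℝ)))).congr
    fun z hz => ?_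
  exact inner_riemGrad_coordVec hz (hf.mdifferentiable (by simp) _) i

variable [IsContMDiffRiemannianBundle (𝓡 n) ∞ (EuclideanSpace ℝ (Fin n))
  (fun x : M => TangentSpace (𝓡 n) x)]

theorem contDiffOn_gram (c : M) (i j : Fin n) :
    ContDiffOn ℝ ∞ (fun z => Matrix.gram ℝ (coordVec c z) i j) (chartAt 𝔼 c).target := by
  rw [← contMDiffOn_iff_contDiffOn]
  exact (contMDiffOn_coordVec c i).inner_bundle (contMDiffOn_coordVec c j)

theorem contDiffOn_gram_inv (c : M) (i j : Fin n) :
    ContDiffOn ℝ ∞ (fun z => (Matrix.gram ℝ (coordVec c z))⁻¹ i j) (chartAt 𝔼 c).target :=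
  ContDiffOn.matrix_inv (contDiffOn_gram c) (fun _ hz => (det_gram_pos hz).ne') i j

theorem contDiffOn_sqrtDetMetric (c : M) :
    ContDiffOn ℝ ∞ (sqrtDetMetric c) (chartAt 𝔼 c).target :=
  (ContDiffOn.matrix_det (contDiffOn_gram c)).sqrt fun _ hz => (det_gram_pos hz).ne'

theorem contDiffOn_chartCoord_riemGrad {f : M → ℝ} (hf : ContMDiff (𝓡 n) 𝓘(ℝ, ℝ) ∞ f) (c : M)
    (i : Fin n) :
    ContDiffOn ℝ ∞ (fun z => chartCoord c (riemGrad n f ((chartAt 𝔼 c).symm z)) i)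
      (chartAt 𝔼 c).target :=
  (ContDiffOn.sum fun j _ => (contDiffOn_gram_inv c i j).mul
    (contDiffOn_inner_riemGrad_coordVec hf c j)).congr fun _ hz => chartCoord_eq_sum hz _ i

theorem aemeasurable_ofReal_sqrtDetMetric (c : M) :
    AEMeasurable (fun z => ENNReal.ofReal (sqrtDetMetric c z))
      (volume.restrict (chartAt 𝔼 c).target) :=
  ((contDiffOn_sqrtDetMetric c).continuousOn.aemeasurable
    (chartAt 𝔼 c).open_target.measurableSet).ennreal_ofReal

end ChartGeometry

/-! ### Transition maps and chart invariance of the divergence -/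

section ChangeOfCharts

variable {n : ℕ} {M : Type*} [TopologicalSpace M] [ChartedSpace (EuclideanSpace ℝ (Fin n)) M]

local notation "𝔼" => EuclideanSpace ℝ (Fin n)

/-- The transition map between the charts `chartAt c` and `chartAt d`. -/
noncomputable def chartChange (c d : M) (z : EuclideanSpace ℝ (Fin n)) :
    EuclideanSpace ℝ (Fin n) :=
  chartAt (EuclideanSpace ℝ (Fin n)) d ((chartAt (EuclideanSpace ℝ (Fin n)) c).symm z)

/-- The domain of the transition map `chartChange c d`. -/
def chartOverlap (c d : M) : Set (EuclideanSpace ℝ (Fin n)) :=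
  (chartAt (EuclideanSpace ℝ (Fin n)) c).target ∩
    (chartAt (EuclideanSpace ℝ (Fin n)) c).symm ⁻¹' (chartAt (EuclideanSpace ℝ (Fin n)) d).source

theorem isOpen_chartOverlap (c d : M) : IsOpen (chartOverlap (n := n) c d) :=
  (chartAt 𝔼 c).isOpen_inter_preimage_symm (chartAt 𝔼 d).open_source

theorem chartAt_symm_chartChange {c d : M} {z : 𝔼} (hz : z ∈ chartOverlap c d) :
    (chartAt 𝔼 d).symm (chartChange c d z) = (chartAt 𝔼 c).symm z :=
  (chartAt 𝔼 d).left_inv hz.2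

theorem injOn_chartChange (c d : M) : InjOn (chartChange (n := n) c d) (chartOverlap c d) := by
  intro y hy z hz h
  refine (chartAt 𝔼 c).symm.injOn hy.1 hz.1 ?_
  rw [← chartAt_symm_chartChange hy, h, chartAt_symm_chartChange hz]

variable [IsManifold (𝓡 n) ∞ M]

theorem contDiffOn_chartChange (c d : M) :
    ContDiffOn ℝ ∞ (chartChange (n := n) c d) (chartOverlap c d) := by
  rw [← contMDiffOn_iff_contDiffOn]
  exact (contMDiffOn_chart (I := 𝓡 n) (x := d)).comp
    ((contMDiffOn_chart_symm (I := 𝓡 n) (x := c)).mono inter_subset_left) fun z hz => hz.2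

theorem chartCoord_chartChange {c d : M} {z : 𝔼} (hz : z ∈ chartOverlap c d)
    (v : TangentSpace (𝓡 n) ((chartAt 𝔼 c).symm z)) :
    chartCoord d v = fderiv ℝ (chartChange c d) z (chartCoord c v) := by
  have h := (mdifferentiable_chartAt c).symm_comp_deriv ((chartAt 𝔼 c).map_target hz.1)
  rw [(chartAt 𝔼 c).right_inv hz.1] at h
  rw [← mfderiv_eq_fderiv, show chartChange (n := n) c d = chartAt 𝔼 d ∘ (chartAt 𝔼 c).symm from rfl,
    mfderiv_comp z ((mdifferentiable_chartAt d).mdifferentiableAt hz.2)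
      ((mdifferentiable_chartAt c).mdifferentiableAt_symm hz.1)]
  exact congrArg (mfderiv (𝓡 n) (𝓡 n) (chartAt 𝔼 d) ((chartAt 𝔼 c).symm z))
    (DFunLike.congr_fun h v).symm

theorem bijective_fderiv_chartChange {c d : M} {z : 𝔼} (hz : z ∈ chartOverlap c d) :
    Function.Bijective (fderiv ℝ (chartChange c d) z) := by
  rw [← mfderiv_eq_fderiv, show chartChange (n := n) c d = chartAt 𝔼 d ∘ (chartAt 𝔼 c).symm from rfl,
    mfderiv_comp z ((mdifferentiable_chartAt d).mdifferentiableAt hz.2)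
      ((mdifferentiable_chartAt c).mdifferentiableAt_symm hz.1)]
  exact ((mdifferentiable_chartAt d).mfderiv_bijective hz.2).comp
    ((mdifferentiable_chartAt c).symm.mfderiv_bijective hz.1)

theorem exists_equiv_fderiv_chartChange {c d : M} {z : 𝔼} (hz : z ∈ chartOverlap c d) :
    ∃ A : 𝔼 ≃L[ℝ] 𝔼, fderiv ℝ (chartChange c d) z = A :=
  ⟨(LinearEquiv.ofBijective (fderiv ℝ (chartChange c d) z : 𝔼 →ₗ[ℝ] 𝔼)
    (bijective_fderiv_chartChange hz)).toContinuousLinearEquiv, rfl⟩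

theorem det_fderiv_chartChange_ne_zero {c d : M} {z : 𝔼} (hz : z ∈ chartOverlap c d) :
    (fderiv ℝ (chartChange c d) z).det ≠ 0 := by
  obtain ⟨A, hA⟩ := exists_equiv_fderiv_chartChange hz
  rw [hA]
  exact A.toLinearEquiv.isUnit_det'.ne_zero

variable [RiemannianBundle (fun x : M => TangentSpace (𝓡 n) x)]

theorem inner_eq_sum_gram {d x : M} (hx : x ∈ (chartAt 𝔼 d).source) (v w : TangentSpace (𝓡 n) x) :
    inner ℝ v w = ∑ k, ∑ l, chartCoord d v l *
      Matrix.gram ℝ (coordVec d (chartAt 𝔼 d x)) l k * chartCoord d w k := by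
  obtain ⟨z, hz, rfl⟩ : ∃ z ∈ (chartAt 𝔼 d).target, (chartAt 𝔼 d).symm z = x :=
    ⟨chartAt 𝔼 d x, (chartAt 𝔼 d).map_source hx, (chartAt 𝔼 d).left_inv hx⟩
  rw [(chartAt 𝔼 d).right_inv hz, inner_eq_sum_chartCoord hz]
  refine Finset.sum_congr rfl fun k _ => ?_
  rw [real_inner_comm, inner_eq_sum_chartCoord hz, Finset.sum_mul]
  refine Finset.sum_congr rfl fun l _ => ?_
  rw [Matrix.gram_apply, real_inner_comm]
  ring

/-- With `J` the Jacobian matrix of the transition map, the Gram matrices are related by `Jᵀ g J`;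
take determinants and square roots. -/
theorem sqrtDetMetric_chartChange {c d : M} {z : 𝔼} (hz : z ∈ chartOverlap c d) :
    sqrtDetMetric c z =
      |(fderiv ℝ (chartChange c d) z).det| * sqrtDetMetric d (chartChange c d z) := by
  let b := (EuclideanSpace.basisFun (Fin n) ℝ).toBasis
  let J : Matrix (Fin n) (Fin n) ℝ :=
    LinearMap.toMatrix b b (fderiv ℝ (chartChange c d) z : 𝔼 →ₗ[ℝ] 𝔼)
  have hJ : ∀ k i, J k i = chartCoord d (coordVec c z i) k := by
    intro k i
    rw [chartCoord_chartChange hz, chartCoord_coordVec hz.1]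
    simp [J, b, LinearMap.toMatrix_apply]
  have hdetJ : J.det = (fderiv ℝ (chartChange c d) z).det := LinearMap.det_toMatrix b _
  have hg : Matrix.gram ℝ (coordVec c z) =
      J.transpose * Matrix.gram ℝ (coordVec d (chartChange c d z)) * J := by
    ext i j
    rw [Matrix.gram_apply, inner_eq_sum_gram hz.2, Matrix.mul_apply]
    refine Finset.sum_congr rfl fun k _ => ?_
    rw [Matrix.mul_apply, Finset.sum_mul]
    refine Finset.sum_congr rfl fun l _ => ?_
    rw [Matrix.transpose_apply, hJ, hJ]
    rfl
  rw [sqrtDetMetric, sqrtDetMetric, hg, Matrix.det_mul, Matrix.det_mul, Matrix.det_transpose, hdetJ,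
    mul_comm, ← mul_assoc, ← sq, Real.sqrt_mul (sq_nonneg _), Real.sqrt_sq_eq_abs]

variable [IsContMDiffRiemannianBundle (𝓡 n) ∞ (EuclideanSpace ℝ (Fin n))
  (fun x : M => TangentSpace (𝓡 n) x)]

theorem trace_eq_sum_fderiv {W : 𝔼 → 𝔼} {W' : 𝔼 →L[ℝ] 𝔼} {z : 𝔼} (h : HasFDerivAt W W' z) :
    LinearMap.trace ℝ 𝔼 (W' : 𝔼 →ₗ[ℝ] 𝔼) =
      ∑ i, fderiv ℝ (fun y => W y i) z (EuclideanSpace.single i 1) := by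
  rw [trace_eq_sum_apply_single]
  refine Finset.sum_congr rfl fun i _ => ?_
  have := (EuclideanSpace.proj (𝕜 := ℝ) i).hasFDerivAt.comp z h
  rw [show (fun y => W y i) = (EuclideanSpace.proj (𝕜 := ℝ) i) ∘ W from rfl, this.fderiv]
  rfl

/-- The Riemannian divergence can be computed in any chart. -/
theorem riemDiv_eq_in_chart {X : (x : M) → TangentSpace (𝓡 n) x}
    (hX : ∀ (c : M) (i : Fin n), ContDiffOn ℝ ∞
      (fun z => chartCoord c (X ((chartAt 𝔼 c).symm z)) i) (chartAt 𝔼 c).target)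
    {c : M} {z : 𝔼} (hz : z ∈ (chartAt 𝔼 c).target) :
    riemDiv X ((chartAt 𝔼 c).symm z) = (sqrtDetMetric c z)⁻¹ *
      ∑ i, fderiv ℝ (fun y => sqrtDetMetric c y * chartCoord c (X ((chartAt 𝔼 c).symm y)) i) z
        (EuclideanSpace.single i 1) := by
  set d : M := (chartAt 𝔼 c).symm z with hd
  have hzo : z ∈ chartOverlap c d := ⟨hz, mem_chart_source 𝔼 d⟩
  have hTz : chartChange c d z ∈ (chartAt 𝔼 d).target := (chartAt 𝔼 d).map_source hzo.2
  let F : (e : M) → 𝔼 → 𝔼 := fun e y =>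
    sqrtDetMetric e y • chartCoord e (X ((chartAt 𝔼 e).symm y))
  have hF : ∀ (e : M) (y : 𝔼), y ∈ (chartAt 𝔼 e).target → HasFDerivAt (F e) (fderiv ℝ (F e) y) y := by
    intro e y hy
    have h1 : ContDiffOn ℝ ∞ (F e) (chartAt 𝔼 e).target :=
      (contDiffOn_sqrtDetMetric e).smul (contDiffOn_euclidean.2 (hX e))
    exact ((h1.contDiffAt ((chartAt 𝔼 e).open_target.mem_nhds hy)).differentiableAt
      (by simp)).hasFDerivAt
  have hnhds : chartOverlap c d ∈ nhds z := (isOpen_chartOverlap c d).mem_nhds hzo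
  have hTs : ContDiffAt ℝ ∞ (chartChange c d) z := (contDiffOn_chartChange c d).contDiffAt hnhds
  -- The density transforms with `|det|`, the Piola identity with `det`. The Jacobian determinant is
  -- continuous and nonzero, so its sign `σ` is constant near `z` and can be absorbed into the field
  -- on the target side.
  obtain ⟨σ, hσ⟩ : ∃ σ : ℝ, ∀ᶠ y in nhds z, |(fderiv ℝ (chartChange c d) y).det| =
      (fderiv ℝ (chartChange c d) y).det * σ := by
    have hcont : ContinuousAt (fun y => (fderiv ℝ (chartChange c d) y).det) z :=
      ContinuousLinearMap.continuous_det.continuousAt.comp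
        (hTs.fderiv_right (m := 0) (by simp)).continuousAt
    rcases lt_or_gt_of_ne (det_fderiv_chartChange_ne_zero hzo) with h | h
    · refine ⟨-1, ?_⟩
      filter_upwards [hcont.eventually_lt continuousAt_const h] with y hy
      rw [abs_of_neg hy, mul_neg_one]
    · refine ⟨1, ?_⟩
      filter_upwards [continuousAt_const.eventually_lt hcont h] with y hy
      rw [abs_of_pos hy, mul_one]
  obtain ⟨A, hA⟩ := exists_equiv_fderiv_chartChange hzo
  have key := trace_fderiv_of_pullback (hTs.of_le ENat.LEInfty.out) A hA (hF c z hz)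
    ((hF d _ hTz).const_smul σ) (by
      filter_upwards [hnhds, hσ] with y hy hyσ
      have h1 : chartCoord d (X ((chartAt 𝔼 d).symm (chartChange c d y))) =
          chartCoord d (X ((chartAt 𝔼 c).symm y)) := by
        rw [chartAt_symm_chartChange hy]
      simp only [F, map_smul, Pi.smul_apply]
      rw [h1, ← chartCoord_chartChange hy, sqrtDetMetric_chartChange hy, hyσ, smul_smul, smul_smul])
  have h2 : LinearMap.trace ℝ 𝔼 ((σ • fderiv ℝ (F d) (chartChange c d z) : 𝔼 →L[ℝ] 𝔼) : 𝔼 →ₗ[ℝ] 𝔼) =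
      σ * LinearMap.trace ℝ 𝔼 (fderiv ℝ (F d) (chartChange c d z) : 𝔼 →ₗ[ℝ] 𝔼) := by
    rw [← smul_eq_mul, ← map_smul]
    rfl
  rw [h2, trace_eq_sum_fderiv (hF c z hz), trace_eq_sum_fderiv (hF d _ hTz), ← mul_assoc, ← hA,
    ← hσ.self_of_nhds] at key
  have h3 : riemDiv X d = (sqrtDetMetric d (chartChange c d z))⁻¹ *
      ∑ i, fderiv ℝ (fun y => F d y i) (chartChange c d z) (EuclideanSpace.single i 1) := rfl
  rw [h3]
  change _ = (sqrtDetMetric c z)⁻¹ * ∑ i, fderiv ℝ (fun y => F c y i) z (EuclideanSpace.single i 1)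
  rw [key, sqrtDetMetric_chartChange hzo, mul_inv]
  have h5 := abs_ne_zero.2 (det_fderiv_chartChange_ne_zero hzo)
  field_simp

end ChangeOfCharts

/-! ### The Riemannian volume in charts -/

section RiemannianVolume

variable {n : ℕ} {M : Type*} [TopologicalSpace M] [ChartedSpace (EuclideanSpace ℝ (Fin n)) M]

local notation "𝔼" => EuclideanSpace ℝ (Fin n)

theorem measurableSet_target_inter_preimage [MeasurableSpace M] [BorelSpace M] (c : M)
    {A : Set M} (hA : MeasurableSet A) :
    MeasurableSet ((chartAt 𝔼 c).target ∩ (chartAt 𝔼 c).symm ⁻¹' A) := by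
  have h : Measurable ((chartAt 𝔼 c).target.domRestrict (chartAt 𝔼 c).symm) :=
    (continuousOn_iff_continuous_domRestrict.1 (chartAt 𝔼 c).continuousOn_symm).measurable
  have h2 := (chartAt 𝔼 c).open_target.measurableSet.subtype_image (h hA)
  convert h2 using 1
  ext z
  simp [and_comm]

theorem aemeasurable_chartAt_symm [MeasurableSpace M] [BorelSpace M] (c : M) :
    AEMeasurable (chartAt 𝔼 c).symm (volume.restrict (chartAt 𝔼 c).target) :=
  (chartAt 𝔼 c).continuousOn_symm.aemeasurable (chartAt 𝔼 c).open_target.measurableSet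

variable [RiemannianBundle (fun x : M => TangentSpace (𝓡 n) x)]

/-- The measure `√(det (gᵢⱼ)) dz` on the target of the chart `chartAt c`. -/
noncomputable def chartDensity (c : M) : Measure (EuclideanSpace ℝ (Fin n)) :=
  ((volume : Measure (EuclideanSpace ℝ (Fin n))).restrict
    (chartAt (EuclideanSpace ℝ (Fin n)) c).target).withDensity
      (fun z => ENNReal.ofReal (sqrtDetMetric c z))

theorem chartDensity_ae_mem (c : M) : ∀ᵐ z ∂(chartDensity (n := n) c), z ∈ (chartAt 𝔼 c).target :=
  (withDensity_absolutelyContinuous _ _).ae_le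
    (ae_restrict_mem (chartAt 𝔼 c).open_target.measurableSet)

variable [MeasurableSpace M] [BorelSpace M]

theorem aemeasurable_chartAt_symm_chartDensity (c : M) :
    AEMeasurable (chartAt 𝔼 c).symm (chartDensity c) :=
  (aemeasurable_chartAt_symm c).mono_ac (withDensity_absolutelyContinuous _ _)

theorem chartVolume_apply (c : M) {A : Set M} (hA : MeasurableSet A) :
    chartVolume n c A = ∫⁻ z in (chartAt 𝔼 c).target ∩ (chartAt 𝔼 c).symm ⁻¹' A,
      ENNReal.ofReal (sqrtDetMetric c z) := by
  rw [chartVolume, Measure.map_apply_of_aemeasurable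
    ((aemeasurable_chartAt_symm c).mono_ac (withDensity_absolutelyContinuous _ _)) hA,
    withDensity_apply', Measure.restrict_restrict' (chartAt 𝔼 c).open_target.measurableSet,
    inter_comm]

theorem chartVolume_compl_source (c : M) : chartVolume n c (chartAt 𝔼 c).sourceᶜ = 0 := by
  rw [chartVolume_apply c (chartAt 𝔼 c).open_source.measurableSet.compl]
  have : (chartAt 𝔼 c).target ∩ (chartAt 𝔼 c).symm ⁻¹' (chartAt 𝔼 c).sourceᶜ = ∅ := by
    ext z
    simp only [mem_inter_iff, mem_preimage, mem_compl_iff, mem_empty_iff_false, iff_false, not_and,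
      not_not]
    exact fun hz => (chartAt 𝔼 c).map_target hz
  rw [this, Measure.restrict_empty, lintegral_zero_measure]

theorem chartVolume_restrict_source (c : M) :
    (chartVolume n c).restrict (chartAt 𝔼 c).source = chartVolume n c := by
  refine Measure.restrict_eq_self_of_ae_mem ?_
  rw [ae_iff]
  exact chartVolume_compl_source c

/-- For the converse, push the chart volume back by the chart, which is almost everywhere inverse to
the parametrization. The integral formulas below can then be stated without measurability
assumptions. -/
theorem aestronglyMeasurable_chartVolume_iff (c : M) (f : M → ℝ) :
    AEStronglyMeasurable f (chartVolume n c) ↔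
      AEStronglyMeasurable (f ∘ (chartAt 𝔼 c).symm) (chartDensity c) := by
  refine ⟨fun h => h.comp_aemeasurable (aemeasurable_chartAt_symm_chartDensity c), fun h => ?_⟩
  have hφ : AEMeasurable (chartAt 𝔼 c) (chartVolume n c) := by
    rw [← chartVolume_restrict_source]
    exact (chartAt 𝔼 c).continuousOn.aemeasurable (chartAt 𝔼 c).open_source.measurableSet
  have hmap : (chartVolume n c).map (chartAt 𝔼 c) = chartDensity c := by
    have h1 : (chartVolume n c).map (chartAt 𝔼 c) =
        (chartDensity c).map (chartAt 𝔼 c ∘ (chartAt 𝔼 c).symm) :=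
      AEMeasurable.map_map_of_aemeasurable hφ (aemeasurable_chartAt_symm_chartDensity c)
    rw [h1]
    conv_rhs => rw [← Measure.map_id (μ := chartDensity (n := n) c)]
    refine Measure.map_congr ?_
    filter_upwards [chartDensity_ae_mem c] with z hz using (chartAt 𝔼 c).right_inv hz
  have h2 := (hmap ▸ h).comp_aemeasurable hφ
  refine h2.congr ?_
  rw [← chartVolume_restrict_source]
  filter_upwards [ae_restrict_mem (chartAt 𝔼 c).open_source.measurableSet] with x hx
  simp [(chartAt 𝔼 c).left_inv hx]

variable [IsManifold (𝓡 n) ∞ M]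

/-- Change of variables along the transition map: its Jacobian is exactly the factor relating the
two densities. -/
theorem chartVolume_eq_of_subset {c d : M} {A : Set M} (hA : MeasurableSet A)
    (hc : A ⊆ (chartAt 𝔼 c).source) (hd : A ⊆ (chartAt 𝔼 d).source) :
    chartVolume n c A = chartVolume n d A := by
  rw [chartVolume_apply c hA, chartVolume_apply d hA]
  set B := (chartAt 𝔼 c).target ∩ (chartAt 𝔼 c).symm ⁻¹' A with hB
  have hBo : B ⊆ chartOverlap c d := fun z hz => ⟨hz.1, hd hz.2⟩
  have himage : (chartAt 𝔼 d).target ∩ (chartAt 𝔼 d).symm ⁻¹' A = chartChange c d '' B := by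
    ext w
    constructor
    · rintro ⟨hw, hwA⟩
      refine ⟨chartAt 𝔼 c ((chartAt 𝔼 d).symm w), ⟨(chartAt 𝔼 c).map_source (hc hwA), ?_⟩, ?_⟩
      · rw [mem_preimage, (chartAt 𝔼 c).left_inv (hc hwA)]
        exact hwA
      · rw [chartChange, (chartAt 𝔼 c).left_inv (hc hwA), (chartAt 𝔼 d).right_inv hw]
    · rintro ⟨z, hz, rfl⟩
      refine ⟨(chartAt 𝔼 d).map_source (hBo hz).2, ?_⟩
      rw [mem_preimage, chartAt_symm_chartChange (hBo hz)]
      exact hz.2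
  have hder : ∀ z ∈ B, HasFDerivWithinAt (chartChange c d) (fderiv ℝ (chartChange c d) z) B z :=
    fun z hz => ((((contDiffOn_chartChange c d).contDiffAt
      ((isOpen_chartOverlap c d).mem_nhds (hBo hz))).differentiableAt
        (by simp)).hasFDerivAt).hasFDerivWithinAt
  rw [himage, lintegral_image_eq_lintegral_abs_det_fderiv_mul volume
    (measurableSet_target_inter_preimage c hA) hder ((injOn_chartChange c d).mono hBo)]
  refine setLIntegral_congr_fun (measurableSet_target_inter_preimage c hA) fun z hz => ?_
  rw [sqrtDetMetric_chartChange (hBo hz), ENNReal.ofReal_mul (abs_nonneg _)]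

theorem riemVolume_restrict_source (c : M) :
    (riemVolume n M).restrict (chartAt 𝔼 c).source = chartVolume n c := by
  have hS : MeasurableSet (chartAt 𝔼 c).source := (chartAt 𝔼 c).open_source.measurableSet
  refine le_antisymm ?_ ?_
  -- A supremum of measures is not computed set by set, so an explicit upper bound is used: the
  -- volume of the chart `c`, plus the infinite measure off its source. The extra term disappears on
  -- restriction.
  · have hle : riemVolume n M ≤ chartVolume n c + (⊤ : Measure M).restrict (chartAt 𝔼 c).sourceᶜ := by
      refine iSup_le fun d => ?_
      rw [← Measure.restrict_add_restrict_compl (μ := chartVolume n d) hS]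
      refine add_le_add (Measure.le_iff.2 fun A hA => ?_) (Measure.restrict_mono le_rfl le_top)
      rw [Measure.restrict_apply hA]
      calc chartVolume n d (A ∩ (chartAt 𝔼 c).source)
          = chartVolume n d (A ∩ (chartAt 𝔼 c).source ∩ (chartAt 𝔼 d).source) := by
            conv_lhs => rw [← chartVolume_restrict_source d, Measure.restrict_apply (hA.inter hS)]
        _ = chartVolume n c (A ∩ (chartAt 𝔼 c).source ∩ (chartAt 𝔼 d).source) :=
            chartVolume_eq_of_subset
              ((hA.inter hS).inter (chartAt 𝔼 d).open_source.measurableSet) inter_subset_right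
              (inter_subset_left.trans inter_subset_right)
        _ ≤ chartVolume n c A := measure_mono (inter_subset_left.trans inter_subset_left)
    refine (Measure.restrict_mono le_rfl hle).trans ?_
    rw [Measure.restrict_add, Measure.restrict_restrict hS, inter_compl_self,
      Measure.restrict_empty, add_zero]
    exact Measure.restrict_le_self
  · conv_lhs => rw [← chartVolume_restrict_source c]
    exact Measure.restrict_mono le_rfl (le_iSup (fun d : M => chartVolume n d) c)

variable [IsContMDiffRiemannianBundle (𝓡 n) ∞ (EuclideanSpace ℝ (Fin n))
    (fun x : M => TangentSpace (𝓡 n) x)]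

theorem integrable_chartVolume_iff (c : M) (f : M → ℝ) :
    Integrable f (chartVolume n c) ↔ IntegrableOn
      (fun z => sqrtDetMetric c z * f ((chartAt 𝔼 c).symm z)) (chartAt 𝔼 c).target := by
  have h1 : Integrable f (chartVolume n c) ↔
      Integrable (f ∘ (chartAt 𝔼 c).symm) (chartDensity c) := by
    by_cases hf : AEStronglyMeasurable f (chartVolume n c)
    · exact integrable_map_measure hf (aemeasurable_chartAt_symm_chartDensity c)
    · exact iff_of_false (fun h => hf h.1)
        fun h => hf ((aestronglyMeasurable_chartVolume_iff c f).2 h.1)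
  rw [h1, chartDensity, integrable_withDensity_iff_integrable_smul₀'
    (aemeasurable_ofReal_sqrtDetMetric c) (by simp), IntegrableOn]
  simp only [smul_eq_mul, Function.comp_apply, sqrtDetMetric, ENNReal.toReal_ofReal (Real.sqrt_nonneg _)]

theorem integral_chartVolume (c : M) (f : M → ℝ) :
    ∫ x, f x ∂(chartVolume n c) =
      ∫ z in (chartAt 𝔼 c).target, sqrtDetMetric c z * f ((chartAt 𝔼 c).symm z) := by
  by_cases hf : AEStronglyMeasurable f (chartVolume n c)
  · have h1 : ∫ x, f x ∂(chartVolume n c) =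
        ∫ z, f ((chartAt 𝔼 c).symm z) ∂(chartDensity c) :=
      integral_map (aemeasurable_chartAt_symm_chartDensity c) hf
    rw [h1, chartDensity, integral_withDensity_eq_integral_toReal_smul₀
      (aemeasurable_ofReal_sqrtDetMetric c) (by simp)]
    simp only [smul_eq_mul, sqrtDetMetric, ENNReal.toReal_ofReal (Real.sqrt_nonneg _)]
  -- Without measurability neither side is integrable, and both integrals take the default value
  -- `0`.
  · rw [integral_undef fun h => hf h.1,
      integral_undef fun h => hf ((integrable_chartVolume_iff c f).2 h).1]

theorem integrable_riemVolume_iff (c : M) {f : M → ℝ} (hf : ∀ x, x ∉ (chartAt 𝔼 c).source → f x = 0) :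
    Integrable f (riemVolume n M) ↔ IntegrableOn
      (fun z => sqrtDetMetric c z * f ((chartAt 𝔼 c).symm z)) (chartAt 𝔼 c).target := by
  rw [← integrable_chartVolume_iff, ← riemVolume_restrict_source]
  exact (integrableOn_iff_integrable_of_support_subset (Function.support_subset_iff'.2 hf)).symm

theorem integral_riemVolume (c : M) {f : M → ℝ} (hf : ∀ x, x ∉ (chartAt 𝔼 c).source → f x = 0) :
    ∫ x, f x ∂(riemVolume n M) =
      ∫ z in (chartAt 𝔼 c).target, sqrtDetMetric c z * f ((chartAt 𝔼 c).symm z) := by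
  rw [← integral_chartVolume, ← riemVolume_restrict_source]
  exact (setIntegral_eq_integral_of_forall_compl_eq_zero hf).symm

/-- The density `√(det g)` is positive on the chart target, so null sets for the volume are Lebesgue
null in coordinates. -/
theorem ae_chart_of_ae_riemVolume {U : Set M} (hU : IsOpen U) {p : M → Prop}
    (h : ∀ᵐ x ∂(riemVolume n M).restrict U, p x) (c : M) :
    ∀ᵐ z ∂volume.restrict ((chartAt 𝔼 c).target ∩ (chartAt 𝔼 c).symm ⁻¹' U),
      p ((chartAt 𝔼 c).symm z) := by
  have hle : chartVolume n c ≤ riemVolume n M := le_iSup (fun d : M => chartVolume n d) c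
  have h1 : ∀ᵐ x ∂(chartVolume n c), x ∈ U → p x :=
    ae_mono hle ((ae_restrict_iff' hU.measurableSet).1 h)
  have h2 : ∀ᵐ z ∂(chartDensity (n := n) c),
      (chartAt 𝔼 c).symm z ∈ U → p ((chartAt 𝔼 c).symm z) :=
    ae_of_ae_map (aemeasurable_chartAt_symm_chartDensity c) h1
  rw [chartDensity, ae_withDensity_iff' (aemeasurable_ofReal_sqrtDetMetric c),
    ae_restrict_iff' (chartAt 𝔼 c).open_target.measurableSet] at h2
  rw [ae_restrict_iff' (measurableSet_target_inter_preimage c hU.measurableSet)]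
  filter_upwards [h2] with z hz hzU
  exact hz hzU.1 (by simpa using sqrtDetMetric_pos hzU.1) hzU.2

end RiemannianVolume

/-! ### Local approximation of functions with bounded weak derivatives -/

section WeakDerivativeApproximation

variable {n : ℕ}

local notation "𝔼" => EuclideanSpace ℝ (Fin n)

theorem integrable_mul_of_eq_zero_off {K : Set 𝔼} (hK : IsCompact K) {w G : 𝔼 → ℝ}
    (hw : ContinuousOn w K) (h0 : ∀ z, z ∉ K → w z = 0) (hG : IntegrableOn G K) :
    Integrable (fun z => w z * G z) :=
  (integrableOn_iff_integrable_of_support_subset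
    (Function.support_subset_iff'.2 fun z hz => by rw [h0 z hz, zero_mul])).1
      (hG.continuousOn_mul hw hK)

theorem integral_fderiv_eq_zero {η : 𝔼 → ℝ} (hη : ContDiff ℝ 1 η) (hs : HasCompactSupport η)
    (v : 𝔼) : ∫ z, fderiv ℝ η z v = 0 := by
  have h1 : Integrable fun z => fderiv ℝ η z v :=
    ((hη.continuous_fderiv (by simp)).clm_apply continuous_const).integrable_of_hasCompactSupport
      (hs.fderiv_apply (𝕜 := ℝ) v)
  have h := integral_mul_fderiv_eq_neg_fderiv_mul_of_integrable (μ := volume) (f := fun _ : 𝔼 => (1 : ℝ))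
    (g := η) (v := v) (by simp) (by simpa using h1)
    (by simpa using hη.continuous.integrable_of_hasCompactSupport hs)
    (fun _ _ => differentiableAt_const _) (fun z _ => hη.differentiable (by simp) z)
  simpa using h

open Filter Topology in
/-- A positive continuous function with locally bounded weak derivatives on an open set is
approximated on a compact subset by positive smooth functions, with convergence almost everywhere of
the derivatives. -/
theorem exists_contDiff_tendsto_of_weak_deriv_on {O K : Set 𝔼} (hO : IsOpen O) (hK : IsCompact K)
    (hKO : K ⊆ O) {r : 𝔼 → ℝ} (hr : ContinuousOn r O) (hr0 : ∀ z ∈ O, 0 < r z)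
    {G : Fin n → 𝔼 → ℝ} (hG : ∀ i, LocallyIntegrableOn (G i) O volume)
    {b : Fin n → 𝔼 → ℝ} (hb : ∀ i, ContinuousOn (b i) O)
    (hGb : ∀ i, ∀ᵐ z ∂volume.restrict O, |G i z| ≤ b i z)
    (hweak : ∀ i, ∀ η : 𝔼 → ℝ, ContDiff ℝ ∞ η → HasCompactSupport η → tsupport η ⊆ O →
      ∫ z, r z * fderiv ℝ η z (EuclideanSpace.single i 1) = -∫ z, G i z * η z) :
    ∃ (s : ℕ → 𝔼 → ℝ) (δ D L : ℝ), 0 < δ ∧ (∀ k, ContDiff ℝ ∞ (s k)) ∧ (∀ k z, δ ≤ s k z) ∧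
      (∀ k z, s k z ≤ D) ∧ (∀ z ∈ K, Tendsto (fun k => s k z) atTop (𝓝 (r z))) ∧
      (∀ k i z, |fderiv ℝ (s k) z (EuclideanSpace.single i 1)| ≤ L) ∧
      ∀ i, ∀ᵐ z, z ∈ K → Tendsto (fun k => fderiv ℝ (s k) z (EuclideanSpace.single i 1)) atTop
        (𝓝 (G i z)) := by
  obtain ⟨K', hK', hKK', hK'O⟩ := exists_compact_between hK hO hKO
  obtain ⟨θ', hθ1, hθ0, hθ01⟩ := exists_contMDiffMap_one_nhds_of_subset_interior (n := (⊤ : ℕ∞))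
    𝓘(ℝ, EuclideanSpace ℝ (Fin n)) hK.isClosed hKK'
  obtain ⟨θ, hθdef⟩ : ∃ θ : 𝔼 → ℝ, θ = θ' := ⟨_, rfl⟩
  have hθ : ContDiff ℝ ∞ θ := by rw [hθdef]; exact θ'.contMDiff.contDiff
  rw [← hθdef] at hθ1 hθ0 hθ01
  have hθK : ∀ z ∈ K, θ =ᶠ[𝓝 z] fun _ => 1 := fun z hz => hθ1.filter_mono (nhds_le_nhdsSet hz)
  have hθt : tsupport θ ⊆ K' :=
    closure_minimal (Function.support_subset_iff'.2 hθ0) hK'.isClosed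
  let e : Fin n → 𝔼 := fun i => EuclideanSpace.single i 1
  let θd : Fin n → 𝔼 → ℝ := fun i z => fderiv ℝ θ z (e i)
  have hθd : ∀ i, Continuous (θd i) := fun i =>
    (hθ.continuous_fderiv (by simp)).clm_apply continuous_const
  have hθd0 : ∀ i z, z ∉ K' → θd i z = 0 := by
    intro i z hz
    have : fderiv ℝ θ z = 0 := fderiv_of_notMem_tsupport (𝕜 := ℝ) fun h => hz (hθt h)
    simp [θd, this]
  have hq : ContinuousOn (fun z => r z - 1) O := hr.sub continuousOn_const
  have hcont : ∀ w : 𝔼 → ℝ, Continuous w → (∀ z, z ∉ K' → w z = 0) →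
      Continuous fun z => (r z - 1) * w z := fun w hw hw0 => by
    rw [← contDiff_zero (𝕜 := ℝ)]
    exact contDiff_of_eq_zero_off hK'.isClosed hO hK'O
      (contDiffOn_zero.2 (hq.mul hw.continuousOn)) fun z hz => by rw [hw0 z hz, mul_zero]
  have hsupp : ∀ w : 𝔼 → ℝ, (∀ z, z ∉ K' → w z = 0) → HasCompactSupport w := fun w hw0 =>
    HasCompactSupport.intro hK' hw0
  obtain ⟨δ0, hδ0, hδ0r⟩ := hK'.exists_forall_le' (hr.mono hK'O) (a := 0) fun z hz => hr0 z (hK'O hz)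
  obtain ⟨D0, hD0⟩ := hK'.exists_bound_of_continuousOn (hr.mono hK'O)
  -- The interpolation equals `r` near `K` and `1` off `K'`. Unlike `θ r`, it is bounded below by a
  -- positive constant, so real powers of its mollifications remain under control.
  let f : 𝔼 → ℝ := fun z => 1 + (r z - 1) * θ z
  have hf : Continuous f := continuous_const.add (hcont θ hθ.continuous hθ0)
  have hfK' : ∀ z, z ∉ K' → f z = 1 := fun z hz => by simp [f, hθ0 z hz]
  have hδ : ∀ z, min δ0 1 ≤ f z := by
    intro z
    by_cases hz : z ∈ K'
    · have h1 := hδ0r z hz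
      have h2 := (hθ01 z).1
      have h3 := (hθ01 z).2
      have h4 := mul_le_mul_of_nonneg_right (min_le_left δ0 1 |>.trans h1) h2
      have h5 := mul_le_mul_of_nonneg_right (min_le_right δ0 1) (sub_nonneg.2 h3)
      simp only [f]
      linarith
    · rw [hfK' z hz]
      exact min_le_right _ _
  have hD : ∀ z, f z ≤ max D0 1 := by
    intro z
    by_cases hz : z ∈ K'
    · have h1 := (le_abs_self _).trans (hD0 z hz)
      have h2 := (hθ01 z).1
      have h3 := (hθ01 z).2
      have h4 := mul_le_mul_of_nonneg_right (h1.trans (le_max_left D0 1)) h2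
      have h5 := mul_le_mul_of_nonneg_right (le_max_right D0 1) (sub_nonneg.2 h3)
      simp only [f]
      linarith
    · rw [hfK' z hz]
      exact le_max_right _ _
  -- The weak gradient of `f` predicted by the product rule; it equals `G` on `K`, where `θ` is
  -- locally constant.
  let P : Fin n → 𝔼 → ℝ := fun i z => θ z * G i z + (r z - 1) * θd i z
  have hGint : ∀ i, IntegrableOn (G i) K' := fun i => (hG i).integrableOn_compact_subset hK'O hK'
  have hP : ∀ i, AEStronglyMeasurable (P i) volume := fun i =>
    (integrable_mul_of_eq_zero_off hK' hθ.continuous.continuousOn hθ0 (hGint i)).1.add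
      (hcont _ (hθd i) (hθd0 i)).aestronglyMeasurable
  have hbd : ∀ i, ∃ L, ∀ᵐ z, |P i z| ≤ L := by
    intro i
    obtain ⟨L1, hL1⟩ := hK'.exists_bound_of_continuousOn ((hb i).mono hK'O)
    obtain ⟨L2, hL2⟩ := HasCompactSupport.exists_bound_of_continuous
      (hsupp (fun z => (r z - 1) * θd i z) fun z hz => by rw [hθd0 i z hz, mul_zero])
      (hcont _ (hθd i) (hθd0 i))
    refine ⟨|L1| + L2, ?_⟩
    filter_upwards [(ae_restrict_iff' hO.measurableSet).1 (hGb i)] with z hz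
    refine (abs_add_le _ _).trans (add_le_add ?_ (hL2 z))
    by_cases hzK : z ∈ K'
    · rw [abs_mul, abs_of_nonneg (hθ01 z).1]
      refine (mul_le_of_le_one_left (abs_nonneg _) (hθ01 z).2).trans ?_
      exact (hz (hK'O hzK)).trans ((le_abs_self _).trans ((hL1 z hzK).trans (le_abs_self _)))
    · simp [hθ0 z hzK]
  choose L0 hL0 using hbd
  obtain ⟨L, hL⟩ := Finite.exists_le L0
  have hweak' : ∀ i, ∀ η : 𝔼 → ℝ, ContDiff ℝ ∞ η → HasCompactSupport η →
      ∫ z, f z * fderiv ℝ η z (e i) = -∫ z, P i z * η z := by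
    intro i η hη hηs
    have hηd : Continuous fun z => fderiv ℝ η z (e i) :=
      (hη.continuous_fderiv (by simp)).clm_apply continuous_const
    have hI1 : Integrable fun z => fderiv ℝ η z (e i) :=
      hηd.integrable_of_hasCompactSupport (hηs.fderiv_apply (𝕜 := ℝ) (e i))
    have hθη : ContDiff ℝ ∞ fun z => θ z * η z := hθ.mul hη
    have hθη0 : ∀ z, z ∉ K' → θ z * η z = 0 := fun z hz => by rw [hθ0 z hz, zero_mul]
    have hθηt : tsupport (fun z => θ z * η z) ⊆ O :=
      (closure_minimal (Function.support_subset_iff'.2 hθη0) hK'.isClosed).trans hK'O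
    have hder : ∀ z, fderiv ℝ (fun z => θ z * η z) z (e i) =
        θ z * fderiv ℝ η z (e i) + η z * θd i z := by
      intro z
      rw [fderiv_fun_mul (hθ.differentiable (by simp) z) (hη.differentiable (by simp) z)]
      simp [θd]
    have hcη : Continuous fun z => (r z - 1) * (θ z * fderiv ℝ η z (e i)) :=
      hcont _ (hθ.continuous.mul hηd) fun z hz => by rw [hθ0 z hz, zero_mul]
    have hcη' : Continuous fun z => (r z - 1) * (η z * θd i z) :=
      hcont _ (hη.continuous.mul (hθd i)) fun z hz => by rw [hθd0 i z hz, mul_zero]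
    have hI2 : Integrable fun z => (r z - 1) * (θ z * fderiv ℝ η z (e i)) :=
      hcη.integrable_of_hasCompactSupport
        (hsupp _ fun z hz => by rw [hθ0 z hz, zero_mul, mul_zero])
    have hI3 : Integrable fun z => (r z - 1) * (η z * θd i z) :=
      hcη'.integrable_of_hasCompactSupport
        (hsupp _ fun z hz => by rw [hθd0 i z hz, mul_zero, mul_zero])
    have hI4 : Integrable fun z => (θ z * η z) * G i z :=
      integrable_mul_of_eq_zero_off hK' hθη.continuous.continuousOn hθη0 (hGint i)
    have hI5 : Integrable fun z => fderiv ℝ (fun z => θ z * η z) z (e i) :=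
      ((hθη.continuous_fderiv (by simp)).clm_apply continuous_const).integrable_of_hasCompactSupport
        ((hsupp _ hθη0).fderiv_apply (𝕜 := ℝ) (e i))
    have hw := hweak i _ hθη (hsupp _ hθη0) hθηt
    have h0 := integral_fderiv_eq_zero (hη.of_le (by simp)) hηs (e i)
    have h0' := integral_fderiv_eq_zero (hθη.of_le (by simp)) (hsupp _ hθη0) (e i)
    -- Writing `r = (r - 1) + 1` isolates a total derivative of a compactly supported function,
    -- whose integral vanishes.
    have hsplit : ∀ z, r z * fderiv ℝ (fun z => θ z * η z) z (e i) =
        (r z - 1) * (θ z * fderiv ℝ η z (e i)) + (r z - 1) * (η z * θd i z) +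
          fderiv ℝ (fun z => θ z * η z) z (e i) := by
      intro z
      rw [hder]
      ring
    have h1 : ∫ z, r z * fderiv ℝ (fun z => θ z * η z) z (e i) =
        (∫ z, (r z - 1) * (θ z * fderiv ℝ η z (e i))) + ∫ z, (r z - 1) * (η z * θd i z) := by
      simp only [hsplit]
      refine (integral_add (hI2.add hI3) hI5).trans ?_
      rw [h0', add_zero]
      exact integral_add hI2 hI3
    have h2 : ∫ z, f z * fderiv ℝ η z (e i) = ∫ z, (r z - 1) * (θ z * fderiv ℝ η z (e i)) := by
      rw [show (fun z => f z * fderiv ℝ η z (e i)) =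
        fun z => fderiv ℝ η z (e i) + (r z - 1) * (θ z * fderiv ℝ η z (e i)) from
          funext fun z => by simp only [f]; ring]
      rw [integral_add hI1 hI2, h0, zero_add]
    have h3 : ∫ z, P i z * η z = (∫ z, (θ z * η z) * G i z) + ∫ z, (r z - 1) * (η z * θd i z) := by
      rw [← integral_add hI4 hI3]
      refine integral_congr_ae (Eventually.of_forall fun z => ?_)
      simp only [P]
      ring
    have h4 : ∫ z, G i z * (θ z * η z) = ∫ z, (θ z * η z) * G i z :=
      integral_congr_ae (Eventually.of_forall fun z => mul_comm _ _)
    rw [h1, h4] at hw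
    rw [h2, h3]
    linarith
  obtain ⟨s, hs1, hs2, hs3, hs4, hs5, hs6⟩ := exists_contDiff_tendsto_of_weak_deriv hf hδ hD hP
    (fun i => (hL0 i).mono fun z hz => hz.trans (hL i)) hweak'
  refine ⟨s, min δ0 1, max D0 1, L, lt_min hδ0 one_pos, hs1, hs2, hs3, fun z hz => ?_, hs5,
    fun i => ?_⟩
  · have h1 : f z = r z := by simp [f, (hθK z hz).self_of_nhds]
    exact h1 ▸ hs4 z
  · filter_upwards [hs6 i] with z hz hzK
    have h1 : P i z = G i z := by
      have h2 : θd i z = 0 := by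
        simp only [θd]
        rw [(hθK z hzK).fderiv_eq]
        simp
      simp only [P]
      rw [h2, (hθK z hzK).self_of_nhds]
      ring
    exact h1 ▸ hz

end WeakDerivativeApproximation

/-! ### Divergence form of the affine Laplacian and integration by parts -/

section SupportedCalculus

variable {n : ℕ} {M : Type*} [TopologicalSpace M] [ChartedSpace (EuclideanSpace ℝ (Fin n)) M]

local notation "𝔼" => EuclideanSpace ℝ (Fin n)

theorem isCompact_chartAt_image {c : M} {A : Set M} (hA : IsCompact A)
    (hAc : A ⊆ (chartAt 𝔼 c).source) : IsCompact (chartAt 𝔼 c '' A) :=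
  hA.image_of_continuousOn ((chartAt 𝔼 c).continuousOn.mono hAc)

theorem chartAt_image_subset_target {c : M} {A : Set M} (hAc : A ⊆ (chartAt 𝔼 c).source) :
    chartAt 𝔼 c '' A ⊆ (chartAt 𝔼 c).target := by
  rintro _ ⟨x, hx, rfl⟩
  exact (chartAt 𝔼 c).map_source (hAc hx)

theorem chartAt_symm_mem_iff {c : M} {A : Set M} (hAc : A ⊆ (chartAt 𝔼 c).source) {z : 𝔼}
    (hz : z ∈ (chartAt 𝔼 c).target) : (chartAt 𝔼 c).symm z ∈ A ↔ z ∈ chartAt 𝔼 c '' A := by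
  refine ⟨fun h => ⟨_, h, (chartAt 𝔼 c).right_inv hz⟩, ?_⟩
  rintro ⟨x, hx, rfl⟩
  rwa [(chartAt 𝔼 c).left_inv (hAc hx)]

variable [RiemannianBundle (fun x : M => TangentSpace (𝓡 n) x)]

theorem riemGrad_eq_zero_of_notMem_tsupport {f : M → ℝ} {x : M} (hx : x ∉ tsupport f) :
    riemGrad n f x = 0 := by
  have h : mfderiv (𝓡 n) 𝓘(ℝ, ℝ) f x = 0 := by
    rw [notMem_tsupport_iff_eventuallyEq] at hx
    rw [hx.mfderiv_eq]
    exact mfderiv_const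
  refine ext_inner_right ℝ fun v => ?_
  rw [inner_riemGrad, h, inner_zero_left]
  rfl

theorem riemDiv_eq_zero_of_eventually {X : (x : M) → TangentSpace (𝓡 n) x} {x : M}
    (hX : ∀ᶠ y in nhds x, X y = 0) : riemDiv X x = 0 := by
  rw [riemDiv, Finset.sum_eq_zero, mul_zero]
  intro i _
  have hx : x ∈ (chartAt 𝔼 x).source := mem_chart_source 𝔼 x
  have hc : ContinuousAt (chartAt 𝔼 x).symm (chartAt 𝔼 x x) :=
    (chartAt 𝔼 x).continuousAt_symm ((chartAt 𝔼 x).map_source hx)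
  rw [ContinuousAt, (chartAt 𝔼 x).left_inv hx] at hc
  have hev : (fun z : 𝔼 => sqrtDetMetric x z * EuclideanSpace.proj (𝕜 := ℝ) i
      (mfderiv (𝓡 n) (𝓡 n) (chartAt 𝔼 x) ((chartAt 𝔼 x).symm z) (X ((chartAt 𝔼 x).symm z))))
      =ᶠ[nhds (chartAt 𝔼 x x)] fun _ => 0 := by
    filter_upwards [hc.eventually hX] with z hz
    have h0 : mfderiv (𝓡 n) (𝓡 n) (chartAt 𝔼 x) ((chartAt 𝔼 x).symm z)
        (X ((chartAt 𝔼 x).symm z)) = 0 := by rw [hz]; exact map_zero _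
    rw [h0]
    exact (congrArg _ (map_zero (EuclideanSpace.proj (𝕜 := ℝ) i))).trans (mul_zero _)
  rw [hev.fderiv_eq]
  simp

theorem affineLaplacian_eq_zero_of_notMem_tsupport (lam mu : ℝ) (u : M → ℝ) {f : M → ℝ} {x : M}
    (hx : x ∉ tsupport f) : affineLaplacian n lam mu u f x = 0 := by
  have h : riemLaplacian n f x = 0 := by
    refine riemDiv_eq_zero_of_eventually ?_
    filter_upwards [(isClosed_tsupport f).isOpen_compl.mem_nhds hx] with y hy
    exact riemGrad_eq_zero_of_notMem_tsupport hy
  rw [affineLaplacian, h, riemGrad_eq_zero_of_notMem_tsupport hx, inner_zero_right]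
  simp

variable [IsManifold (𝓡 n) ∞ M]
  [IsContMDiffRiemannianBundle (𝓡 n) ∞ (EuclideanSpace ℝ (Fin n))
    (fun x : M => TangentSpace (𝓡 n) x)]

/-- The divergence form `V ^ τ Δᴰ ψ = div (V ^ (2μ + nλ) ∇ψ)` of the affine Laplacian, in a
chart. -/
theorem affineLaplacian_in_chart {u : M → ℝ} (hu : ContMDiff (𝓡 n) 𝓘(ℝ, ℝ) ∞ u) (lam mu : ℝ)
    {ψ : M → ℝ} (hψ : ContMDiff (𝓡 n) 𝓘(ℝ, ℝ) ∞ ψ) {c : M} {z : 𝔼}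
    (hz : z ∈ (chartAt 𝔼 c).target) :
    sqrtDetMetric c z * (affineLaplacian n lam mu u ψ ((chartAt 𝔼 c).symm z) *
        Real.exp (u ((chartAt 𝔼 c).symm z)) ^ ((n + 1) * lam + mu)) =
      ∑ i, fderiv ℝ (fun y => Real.exp ((2 * mu + n * lam) * u ((chartAt 𝔼 c).symm y)) *
        (sqrtDetMetric c y * chartCoord c (riemGrad n ψ ((chartAt 𝔼 c).symm y)) i)) z
          (EuclideanSpace.single i 1) := by
  set κ : ℝ := 2 * mu + n * lam with hκ
  set e : Fin n → 𝔼 := fun i => EuclideanSpace.single i (1 : ℝ) with he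
  have hnhds := (chartAt 𝔼 c).open_target.mem_nhds hz
  have hu' : DifferentiableAt ℝ (fun y => u ((chartAt 𝔼 c).symm y)) z :=
    ((contDiffOn_comp_chartAt_symm hu c).contDiffAt hnhds).differentiableAt (by simp)
  let F : Fin n → 𝔼 → ℝ := fun i y =>
    sqrtDetMetric c y * chartCoord c (riemGrad n ψ ((chartAt 𝔼 c).symm y)) i
  have hF : ∀ i, DifferentiableAt ℝ (F i) z := fun i =>
    (((contDiffOn_sqrtDetMetric c).mul (contDiffOn_chartCoord_riemGrad hψ c i)).contDiffAt
      hnhds).differentiableAt (by simp)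
  set a : ℝ := Real.exp (κ * u ((chartAt 𝔼 c).symm z)) with ha
  have hterm : ∀ i, fderiv ℝ (fun y => Real.exp (κ * u ((chartAt 𝔼 c).symm y)) * F i y) z (e i) =
      a * fderiv ℝ (F i) z (e i) +
        a * (κ * (sqrtDetMetric c z * (inner ℝ (riemGrad n u ((chartAt 𝔼 c).symm z))
          (coordVec c z i) * chartCoord c (riemGrad n ψ ((chartAt 𝔼 c).symm z)) i))) := by
    intro i
    have h1 := (hu'.hasFDerivAt.const_mul κ).exp
    rw [(h1.fun_mul (hF i).hasFDerivAt).fderiv,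
      inner_riemGrad_coordVec hz (hu.mdifferentiable (by simp) _) i]
    simp only [add_apply, smul_apply, smul_eq_mul, F]
    rw [show (u ∘ (chartAt 𝔼 c).symm) = fun y => u ((chartAt 𝔼 c).symm y) from rfl]
    ring
  have hdiv : riemLaplacian n ψ ((chartAt 𝔼 c).symm z) =
      (sqrtDetMetric c z)⁻¹ * ∑ i, fderiv ℝ (F i) z (e i) :=
    riemDiv_eq_in_chart (fun d i => contDiffOn_chartCoord_riemGrad hψ d i) hz
  -- The exponents add up to `2μ + nλ`, exactly the drift coefficient in `Δᴰ`; this is why the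
  -- weight `V ^ τ` gives a divergence.
  have hexp : Real.exp (u ((chartAt 𝔼 c).symm z)) ^ (mu - lam) *
      Real.exp (u ((chartAt 𝔼 c).symm z)) ^ ((n + 1) * lam + mu) = a := by
    rw [← Real.exp_mul, ← Real.exp_mul, ← Real.exp_add, ha, hκ]
    congr 1
    ring
  change _ = ∑ i, fderiv ℝ (fun y => Real.exp (κ * u ((chartAt 𝔼 c).symm y)) * F i y) z (e i)
  simp only [hterm, Finset.sum_add_distrib, ← Finset.mul_sum]
  rw [affineLaplacian, hdiv, inner_eq_sum_chartCoord hz, ← hexp]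
  have hs := (sqrtDetMetric_pos hz).ne'
  field_simp
  ring

variable [MeasurableSpace M] [BorelSpace M]

theorem integrable_riemVolume_iff_image {c : M} {A : Set M}
    (hAc : A ⊆ (chartAt 𝔼 c).source) {f : M → ℝ} (hf : ∀ x, x ∉ A → f x = 0) :
    Integrable f (riemVolume n M) ↔ IntegrableOn
      (fun z => sqrtDetMetric c z * f ((chartAt 𝔼 c).symm z)) (chartAt 𝔼 c '' A) := by
  rw [integrable_riemVolume_iff c fun x hx => hf x fun h => hx (hAc h)]
  refine ⟨fun h => h.mono_set (chartAt_image_subset_target hAc),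
    fun h => h.of_forall_sdiff_eq_zero (chartAt 𝔼 c).open_target.measurableSet fun z hz => ?_⟩
  rw [hf _ fun h => hz.2 ((chartAt_symm_mem_iff hAc hz.1).1 h), mul_zero]

theorem integral_riemVolume_image {c : M} {A : Set M}
    (hAc : A ⊆ (chartAt 𝔼 c).source) {f : M → ℝ} (hf : ∀ x, x ∉ A → f x = 0) :
    ∫ x, f x ∂(riemVolume n M) =
      ∫ z in chartAt 𝔼 c '' A, sqrtDetMetric c z * f ((chartAt 𝔼 c).symm z) := by
  rw [integral_riemVolume c fun x hx => hf x fun h => hx (hAc h)]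
  refine setIntegral_eq_of_subset_of_forall_sdiff_eq_zero
    (chartAt 𝔼 c).open_target.measurableSet (chartAt_image_subset_target hAc) fun z hz => ?_
  rw [hf _ fun h => hz.2 ((chartAt_symm_mem_iff hAc hz.1).1 h), mul_zero]

/-- Integration by parts against a weak gradient, for test functions supported in a chart. -/
theorem integral_mul_affineLaplacian {u : M → ℝ} (hu : ContMDiff (𝓡 n) 𝓘(ℝ, ℝ) ∞ u) (lam mu : ℝ)
    {ρ : M → ℝ} (hρ : Continuous ρ) {U : Set M} {G : (x : M) → TangentSpace (𝓡 n) x}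
    (hG : IsWeakGradOn U ρ G) {ψ : M → ℝ} (hψ : ContMDiff (𝓡 n) 𝓘(ℝ, ℝ) ∞ ψ)
    (hψs : HasCompactSupport ψ) (hψU : tsupport ψ ⊆ U) {c : M}
    (hψc : tsupport ψ ⊆ (chartAt 𝔼 c).source) :
    ∫ x, ρ x * affineLaplacian n lam mu u ψ x *
        Real.exp (u x) ^ ((n + 1) * lam + mu) ∂(riemVolume n M) =
      -∫ x, inner ℝ (riemGrad n ψ x) (G x) * Real.exp (u x) ^ (2 * mu + n * lam)
        ∂(riemVolume n M) := by
  set e : Fin n → 𝔼 := fun i => EuclideanSpace.single i (1 : ℝ) with he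
  set K : Set 𝔼 := chartAt 𝔼 c '' tsupport ψ with hKdef
  have hK : IsCompact K := isCompact_chartAt_image hψs hψc
  have hKT : K ⊆ (chartAt 𝔼 c).target := chartAt_image_subset_target hψc
  have hmem : ∀ z ∈ (chartAt 𝔼 c).target, z ∉ K → (chartAt 𝔼 c).symm z ∉ tsupport ψ :=
    fun z hz hzK h => hzK ((chartAt_symm_mem_iff hψc hz).1 h)
  have hKO : K ⊆ (chartAt 𝔼 c).target ∩ (chartAt 𝔼 c).symm ⁻¹' U := fun z hz =>
    ⟨hKT hz, hψU ((chartAt_symm_mem_iff hψc (hKT hz)).2 hz)⟩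
  -- These are the components of `√g V ^ (2μ + nλ) ∇ψ`. Extended by zero they are smooth with
  -- compact support, hence admissible in the definition of the weak gradient of `ρ`.
  let W : Fin n → 𝔼 → ℝ := fun i y =>
    Real.exp ((2 * mu + n * lam) * u ((chartAt 𝔼 c).symm y)) *
      (sqrtDetMetric c y * chartCoord c (riemGrad n ψ ((chartAt 𝔼 c).symm y)) i)
  let Wt : Fin n → 𝔼 → ℝ := fun i => (chartAt 𝔼 c).target.indicator (W i)
  have hWt : ∀ i, ∀ z ∈ (chartAt 𝔼 c).target, Wt i z = W i z := fun i z hz =>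
    indicator_of_mem hz _
  have hWt0 : ∀ i z, z ∉ K → Wt i z = 0 := by
    intro i z hzK
    by_cases hz : z ∈ (chartAt 𝔼 c).target
    · rw [hWt i z hz]
      simp only [W, riemGrad_eq_zero_of_notMem_tsupport (hmem z hz hzK)]
      rw [show chartCoord c (0 : TangentSpace (𝓡 n) ((chartAt 𝔼 c).symm z)) = 0 from map_zero _]
      simp
    · exact indicator_of_notMem hz _
  have hWs : ∀ i, ContDiff ℝ ∞ (Wt i) := fun i =>
    contDiff_of_eq_zero_off hK.isClosed (chartAt 𝔼 c).open_target hKT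
      (((Real.contDiff_exp.comp_contDiffOn
        (contDiffOn_const.mul (contDiffOn_comp_chartAt_symm hu c))).mul
          ((contDiffOn_sqrtDetMetric c).mul (contDiffOn_chartCoord_riemGrad hψ c i))).congr
            (hWt i)) (hWt0 i)
  have hWt_tsupp : ∀ i, tsupport (Wt i) ⊆ K := fun i =>
    closure_minimal (Function.support_subset_iff'.2 (hWt0 i)) hK.isClosed
  have hWd0 : ∀ i z, z ∉ K → fderiv ℝ (Wt i) z (e i) = 0 := fun i z hz => by
    rw [fderiv_of_notMem_tsupport (𝕜 := ℝ) fun h => hz (hWt_tsupp i h)]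
    rfl
  have hρc : ContinuousOn (fun z => ρ ((chartAt 𝔼 c).symm z)) K :=
    hρ.comp_continuousOn ((chartAt 𝔼 c).continuousOn_symm.mono hKT)
  have hI1 : ∀ i, IntegrableOn (fun z => ρ ((chartAt 𝔼 c).symm z) * fderiv ℝ (Wt i) z (e i)) K :=
    fun i => (hρc.mul ((((hWs i).continuous_fderiv (by simp)).clm_apply
      continuous_const).continuousOn)).integrableOn_compact hK
  have hI2 : ∀ i, IntegrableOn
      (fun z => inner ℝ (G ((chartAt 𝔼 c).symm z)) (coordVec c z i) * Wt i z) K :=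
    fun i => ((hG c i).1.integrableOn_compact_subset hKO hK).mul_continuousOn
      (hWs i).continuous.continuousOn hK
  have hleft : ∫ x, ρ x * affineLaplacian n lam mu u ψ x *
        Real.exp (u x) ^ ((n + 1) * lam + mu) ∂(riemVolume n M) =
      ∑ i, ∫ z, ρ ((chartAt 𝔼 c).symm z) * fderiv ℝ (Wt i) z (e i) := by
    rw [integral_riemVolume_image hψc fun x hx => by
      rw [affineLaplacian_eq_zero_of_notMem_tsupport lam mu u hx, mul_zero, zero_mul]]
    have h1 : ∫ z in K, sqrtDetMetric c z * (ρ ((chartAt 𝔼 c).symm z) *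
        affineLaplacian n lam mu u ψ ((chartAt 𝔼 c).symm z) *
          Real.exp (u ((chartAt 𝔼 c).symm z)) ^ ((n + 1) * lam + mu)) =
        ∫ z in K, ∑ i, ρ ((chartAt 𝔼 c).symm z) * fderiv ℝ (Wt i) z (e i) := by
      refine setIntegral_congr_fun hK.measurableSet fun z hz => ?_
      have hder : ∀ i, fderiv ℝ (Wt i) z = fderiv ℝ (W i) z := fun i => by
        refine Filter.EventuallyEq.fderiv_eq ?_
        filter_upwards [(chartAt 𝔼 c).open_target.mem_nhds (hKT hz)] with y hy using hWt i y hy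
      have h2 := affineLaplacian_in_chart hu lam mu hψ (hKT hz)
      simp only [hder, ← Finset.mul_sum]
      change _ = ρ ((chartAt 𝔼 c).symm z) * ∑ i, fderiv ℝ (W i) z (e i)
      rw [← h2]
      ring
    rw [h1, integral_finsetSum _ fun i _ => hI1 i]
    refine Finset.sum_congr rfl fun i _ => ?_
    exact setIntegral_eq_integral_of_forall_compl_eq_zero fun z hz => by
      rw [hWd0 i z hz, mul_zero]
  have hright : ∫ x, inner ℝ (riemGrad n ψ x) (G x) * Real.exp (u x) ^ (2 * mu + n * lam)
        ∂(riemVolume n M) =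
      ∑ i, ∫ z, inner ℝ (G ((chartAt 𝔼 c).symm z)) (coordVec c z i) * Wt i z := by
    rw [integral_riemVolume_image hψc fun x hx => by
      rw [riemGrad_eq_zero_of_notMem_tsupport hx, inner_zero_left, zero_mul]]
    have h1 : ∫ z in K, sqrtDetMetric c z * (inner ℝ (riemGrad n ψ ((chartAt 𝔼 c).symm z))
        (G ((chartAt 𝔼 c).symm z)) *
          Real.exp (u ((chartAt 𝔼 c).symm z)) ^ (2 * mu + n * lam)) =
        ∫ z in K, ∑ i, inner ℝ (G ((chartAt 𝔼 c).symm z)) (coordVec c z i) * Wt i z := by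
      refine setIntegral_congr_fun hK.measurableSet fun z hz => ?_
      simp only [hWt _ z (hKT hz), W]
      rw [real_inner_comm, inner_eq_sum_chartCoord (hKT hz), ← Real.exp_mul, Finset.sum_mul,
        Finset.mul_sum, mul_comm (u _)]
      refine Finset.sum_congr rfl fun i _ => ?_
      ring
    rw [h1, integral_finsetSum _ fun i _ => hI2 i]
    refine Finset.sum_congr rfl fun i _ => ?_
    exact setIntegral_eq_integral_of_forall_compl_eq_zero fun z hz => by
      rw [hWt0 i z hz, mul_zero]
  rw [hleft, hright, ← Finset.sum_neg_distrib]
  refine Finset.sum_congr rfl fun i _ => ?_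
  exact (hG c i).2 (Wt i) (hWs i) (hK.of_isClosed_subset (isClosed_tsupport _) (hWt_tsupp i))
    ((hWt_tsupp i).trans hKO)

end SupportedCalculus

/-! ### Tools for the passage to the limit -/

section LimitPassage

variable {n : ℕ} {M : Type*} [TopologicalSpace M] [ChartedSpace (EuclideanSpace ℝ (Fin n)) M]

local notation "𝔼" => EuclideanSpace ℝ (Fin n)

open Filter Topology in
theorem tendsto_setIntegral_mul_of_bound {K : Set 𝔼} (hK : MeasurableSet K) {g : 𝔼 → ℝ}
    (hg : IntegrableOn g K) {f : ℕ → 𝔼 → ℝ} {f' : 𝔼 → ℝ} (hf : ∀ k, Continuous (f k)) {B : ℝ}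
    (hB : ∀ k z, |f k z| ≤ B)
    (hlim : ∀ᵐ z, z ∈ K → Tendsto (fun k => f k z) atTop (𝓝 (f' z))) :
    Tendsto (fun k => ∫ z in K, f k z * g z) atTop (𝓝 (∫ z in K, f' z * g z)) := by
  refine tendsto_integral_of_dominated_convergence (fun z => B * |g z|)
    (fun k => (hf k).aestronglyMeasurable.mul hg.1) (hg.abs.const_mul B) (fun k => ?_) ?_
  · refine Eventually.of_forall fun z => ?_
    rw [Real.norm_eq_abs, abs_mul]
    exact mul_le_mul_of_nonneg_right (hB k z) (abs_nonneg _)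
  · rw [ae_restrict_iff' hK]
    filter_upwards [hlim] with z hz hzK using (hz hzK).mul_const _

theorem integrableOn_bounded_mul {K : Set 𝔼} {g f : 𝔼 → ℝ} (hg : IntegrableOn g K)
    (hf : Continuous f) {B : ℝ} (hB : ∀ z, |f z| ≤ B) : IntegrableOn (fun z => f z * g z) K :=
  Integrable.bdd_mul hg hf.aestronglyMeasurable (Filter.Eventually.of_forall hB)

/-- The power is monotone, so its maximum is at an endpoint depending on the sign of `p`; the sum of
both endpoint values covers either case. -/
theorem Real.rpow_le_add_of_mem_Icc {δ D s : ℝ} (hδ : 0 < δ) (h1 : δ ≤ s) (h2 : s ≤ D) (p : ℝ) :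
    s ^ p ≤ δ ^ p + D ^ p := by
  have hs := hδ.trans_le h1
  have hδp := (Real.rpow_pos_of_pos hδ p).le
  have hDp := (Real.rpow_pos_of_pos (hs.trans_le h2) p).le
  rcases le_total 0 p with hp | hp
  · linarith [Real.rpow_le_rpow hs.le h2 hp]
  · linarith [Real.rpow_le_rpow_of_nonpos hδ h1 hp]

/-- The chart is smooth only on its source, but the product vanishes off the support of `h`, which
lies inside. -/
theorem contMDiff_comp_chartAt_mul [IsManifold (𝓡 n) ∞ M] {q : EuclideanSpace ℝ (Fin n) → ℝ}
    (hq : ContDiff ℝ ∞ q) {h : M → ℝ} (hh : ContMDiff (𝓡 n) 𝓘(ℝ, ℝ) ∞ h) {c : M}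
    (hc : tsupport h ⊆ (chartAt (EuclideanSpace ℝ (Fin n)) c).source) :
    ContMDiff (𝓡 n) 𝓘(ℝ, ℝ) ∞ fun x => q (chartAt (EuclideanSpace ℝ (Fin n)) c x) * h x := by
  refine contMDiff_of_tsupport fun x hx => ?_
  have hx' : x ∈ (chartAt 𝔼 c).source := hc (tsupport_mul_subset_right hx)
  have h1 : ContMDiffAt (𝓡 n) (𝓡 n) ∞ (chartAt 𝔼 c) x :=
    contMDiffOn_chart.contMDiffAt ((chartAt 𝔼 c).open_source.mem_nhds hx')
  exact (hq.contMDiff.contMDiffAt.comp x h1).mul hh.contMDiffAt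

variable [RiemannianBundle (fun x : M => TangentSpace (𝓡 n) x)] [IsManifold (𝓡 n) ∞ M]

theorem inner_riemGrad_comp_chartAt_mul {q : 𝔼 → ℝ} (hq : ContDiff ℝ ∞ q) {h : M → ℝ}
    (hh : ContMDiff (𝓡 n) 𝓘(ℝ, ℝ) ∞ h) {c : M} (hc : tsupport h ⊆ (chartAt 𝔼 c).source)
    {z : 𝔼} (hz : z ∈ (chartAt 𝔼 c).target) (i : Fin n) :
    inner ℝ (riemGrad n (fun x => q (chartAt 𝔼 c x) * h x) ((chartAt 𝔼 c).symm z))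
        (coordVec c z i) =
      q z * inner ℝ (riemGrad n h ((chartAt 𝔼 c).symm z)) (coordVec c z i) +
        h ((chartAt 𝔼 c).symm z) * fderiv ℝ q z (EuclideanSpace.single i 1) := by
  have hnhds := (chartAt 𝔼 c).open_target.mem_nhds hz
  have hd : DifferentiableAt ℝ (h ∘ (chartAt 𝔼 c).symm) z :=
    ((contDiffOn_comp_chartAt_symm hh c).contDiffAt hnhds).differentiableAt (by simp)
  rw [inner_riemGrad_coordVec hz
    ((contMDiff_comp_chartAt_mul hq hh hc).mdifferentiable (by simp) _) i,
    inner_riemGrad_coordVec hz (hh.mdifferentiable (by simp) _) i]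
  have hev : (fun x => q (chartAt 𝔼 c x) * h x) ∘ (chartAt 𝔼 c).symm =ᶠ[nhds z]
      fun y => q y * (h ∘ (chartAt 𝔼 c).symm) y := by
    filter_upwards [hnhds] with y hy
    simp [(chartAt 𝔼 c).right_inv hy]
  rw [hev.fderiv_eq, fderiv_fun_mul (hq.differentiable (by simp) z) hd]
  simp

variable [IsContMDiffRiemannianBundle (𝓡 n) ∞ (EuclideanSpace ℝ (Fin n))
    (fun x : M => TangentSpace (𝓡 n) x)]

theorem integrableOn_chartCoord {c : M} {K : Set 𝔼} (hK : IsCompact K)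
    (hKT : K ⊆ (chartAt 𝔼 c).target) {G : (x : M) → TangentSpace (𝓡 n) x}
    (hG : ∀ i, IntegrableOn (fun z => inner ℝ (G ((chartAt 𝔼 c).symm z)) (coordVec c z i)) K)
    (i : Fin n) : IntegrableOn (fun z => chartCoord c (G ((chartAt 𝔼 c).symm z)) i) K := by
  have h1 : IntegrableOn (fun z => ∑ j, (Matrix.gram ℝ (coordVec c z))⁻¹ i j *
      inner ℝ (G ((chartAt 𝔼 c).symm z)) (coordVec c z j)) K :=
    integrable_finsetSum _ fun j _ => (hG j).continuousOn_mul
      ((contDiffOn_gram_inv c i j).continuousOn.mono hKT) hK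
  exact h1.congr_fun (fun z hz => (chartCoord_eq_sum (hKT hz) _ i).symm) hK.measurableSet

variable [MeasurableSpace M] [BorelSpace M]

/-- In the chart, the integrand pairs continuous coefficients with the components of `G`, which are
integrable on the compact image of the support. -/
theorem integrable_mul_inner_riemGrad {ρ : M → ℝ} {U : Set M} {G : (x : M) → TangentSpace (𝓡 n) x}
    (hG : IsWeakGradOn U ρ G) {h : M → ℝ} (hh : ContMDiff (𝓡 n) 𝓘(ℝ, ℝ) ∞ h)
    (hhs : HasCompactSupport h) (hhU : tsupport h ⊆ U) {c : M}
    (hhc : tsupport h ⊆ (chartAt 𝔼 c).source) {w : M → ℝ} (hw : ContinuousOn w U) :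
    Integrable (fun x => w x * inner ℝ (riemGrad n h x) (G x)) (riemVolume n M) := by
  have hK : IsCompact (chartAt 𝔼 c '' tsupport h) := isCompact_chartAt_image hhs hhc
  have hKT := chartAt_image_subset_target (n := n) hhc
  have hKO : chartAt 𝔼 c '' tsupport h ⊆ (chartAt 𝔼 c).target ∩ (chartAt 𝔼 c).symm ⁻¹' U :=
    fun z hz => ⟨hKT hz, hhU ((chartAt_symm_mem_iff hhc (hKT hz)).2 hz)⟩
  rw [integrable_riemVolume_iff_image hhc fun x hx => by
    rw [riemGrad_eq_zero_of_notMem_tsupport hx, inner_zero_left, mul_zero]]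
  have hwc : ContinuousOn (fun z => w ((chartAt 𝔼 c).symm z)) (chartAt 𝔼 c '' tsupport h) :=
    hw.comp ((chartAt 𝔼 c).continuousOn_symm.mono hKT) fun z hz => (hKO hz).2
  have h1 : IntegrableOn (fun z => ∑ i, (sqrtDetMetric c z * w ((chartAt 𝔼 c).symm z) *
      inner ℝ (riemGrad n h ((chartAt 𝔼 c).symm z)) (coordVec c z i)) *
        chartCoord c (G ((chartAt 𝔼 c).symm z)) i) (chartAt 𝔼 c '' tsupport h) :=
    integrable_finsetSum _ fun i _ => (integrableOn_chartCoord hK hKT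
      (fun j => (hG c j).1.integrableOn_compact_subset hKO hK) i).continuousOn_mul
        ((((contDiffOn_sqrtDetMetric c).continuousOn.mono hKT).mul hwc).mul
          ((contDiffOn_inner_riemGrad_coordVec hh c i).continuousOn.mono hKT)) hK
  refine h1.congr_fun (fun z hz => ?_) hK.measurableSet
  simp only []
  rw [inner_eq_sum_chartCoord (hKT hz), Finset.mul_sum, Finset.mul_sum]
  exact Finset.sum_congr rfl fun i _ => by ring

end LimitPassage

/-! ### The inequality for test functions supported in a chart -/

section LocalHardyInequality

variable {n : ℕ} {M : Type*} [TopologicalSpace M] [ChartedSpace (EuclideanSpace ℝ (Fin n)) M]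
  [RiemannianBundle (fun x : M => TangentSpace (𝓡 n) x)]

local notation "𝔼" => EuclideanSpace ℝ (Fin n)

theorem norm_eq_of_norm_affineScale_eq_one {lam mu : ℝ} {u : M → ℝ}
    {G : (x : M) → TangentSpace (𝓡 n) x} {x : M} (h : ‖affineScale lam mu u G x‖ = 1) :
    ‖G x‖ = Real.exp (u x) ^ (lam - mu) := by
  have h0 : 0 < Real.exp (u x) := Real.exp_pos _
  rw [affineScale, norm_smul, Real.norm_of_nonneg (Real.rpow_nonneg h0.le _)] at h
  have h1 : Real.exp (u x) ^ (lam - mu) * Real.exp (u x) ^ (mu - lam) = 1 := by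
    rw [← Real.rpow_add h0]
    simp
  calc ‖G x‖ = (Real.exp (u x) ^ (lam - mu) * Real.exp (u x) ^ (mu - lam)) * ‖G x‖ := by
        rw [h1, one_mul]
    _ = Real.exp (u x) ^ (lam - mu) := by rw [mul_assoc, h, mul_one]

/-- Cauchy–Schwarz, with `|∂ᵢ| = √gᵢᵢ`. For `v = G` of known norm this is the continuous bound on
the weak derivatives of `ρ`. -/
theorem abs_inner_coordVec_le {c : M} {z : 𝔼} (v : TangentSpace (𝓡 n) ((chartAt 𝔼 c).symm z))
    (i : Fin n) : |inner ℝ v (coordVec c z i)| ≤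
      ‖v‖ * Real.sqrt (Matrix.gram ℝ (coordVec c z) i i) := by
  refine (abs_real_inner_le_norm _ _).trans (le_of_eq ?_)
  rw [Matrix.gram_apply, real_inner_self_eq_norm_sq, Real.sqrt_sq (norm_nonneg _)]

theorem sum_integral_add_integral {X ι : Type*} [MeasurableSpace X] {ν : Measure X} [Fintype ι]
    {a b : ι → X → ℝ} (ha : ∀ i, Integrable (a i) ν) (hb : ∀ i, Integrable (b i) ν) :
    ∑ i, ((∫ x, a i x ∂ν) + ∫ x, b i x ∂ν) = ∫ x, ∑ i, (a i x + b i x) ∂ν := by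
  refine Eq.trans ?_ (integral_finsetSum _ fun i _ => (ha i).add (hb i)).symm
  exact Finset.sum_congr rfl fun i _ => (integral_add (ha i) (hb i)).symm

variable [IsManifold (𝓡 n) ∞ M]
  [IsContMDiffRiemannianBundle (𝓡 n) ∞ (EuclideanSpace ℝ (Fin n))
    (fun x : M => TangentSpace (𝓡 n) x)] [MeasurableSpace M] [BorelSpace M]

open Filter Topology in
-- Formally, this tests the Laplacian inequality with `ρ ^ (α - 1) h`; the derivative of the power
-- contributes `(α - 1) |G|²` and turns `C` into `C + α - 1`. Rigorously, `ρ` is replaced by smooth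
-- approximants in the test function only, while `C / ρ` and the weak gradient `G` are kept, and the
-- limit is taken afterwards.
theorem integral_le_neg_integral_inner {u : M → ℝ} (hu : ContMDiff (𝓡 n) 𝓘(ℝ, ℝ) ∞ u)
    {lam mu C α : ℝ} {ρ : M → ℝ} (hρ : Continuous ρ) (hρ_nonneg : ∀ x, 0 ≤ ρ x)
    {G : (x : M) → TangentSpace (𝓡 n) x} (hG : IsWeakGradOn (ρ ⁻¹' {0})ᶜ ρ G)
    (hGn : ∀ᵐ x ∂(riemVolume n M).restrict (ρ ⁻¹' {0})ᶜ, ‖affineScale lam mu u G x‖ = 1)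
    (hlap : WeakAffineLaplacianGeOn n lam mu u (ρ ⁻¹' {0})ᶜ ρ
      (fun x => C / ρ x * Real.exp (u x) ^ (lam - mu)))
    {h : M → ℝ} (hh : ContMDiff (𝓡 n) 𝓘(ℝ, ℝ) ∞ h) (hhs : HasCompactSupport h)
    (hhU : tsupport h ⊆ (ρ ⁻¹' {0})ᶜ) (hh0 : ∀ x, 0 ≤ h x) {c : M}
    (hhc : tsupport h ⊆ (chartAt (EuclideanSpace ℝ (Fin n)) c).source) :
    (C + α - 1) * ∫ x, ρ x ^ (α - 2) * h x * Real.exp (u x) ^ ((n + 2) * lam) ∂(riemVolume n M) ≤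
      -∫ x, ρ x ^ (α - 1) * Real.exp (u x) ^ (2 * mu + n * lam) *
        inner ℝ (riemGrad n h x) (G x) ∂(riemVolume n M) := by
  set U : Set M := (ρ ⁻¹' {0})ᶜ with hU
  have hUo : IsOpen U := (isClosed_singleton.preimage hρ).isOpen_compl
  have hρU : ∀ x ∈ U, 0 < ρ x := fun x hx => (hρ_nonneg x).lt_of_ne' hx
  set A : Set M := tsupport h with hA
  set K : Set 𝔼 := chartAt 𝔼 c '' A with hKdef
  set O : Set 𝔼 := (chartAt 𝔼 c).target ∩ (chartAt 𝔼 c).symm ⁻¹' U with hOdef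
  have hO : IsOpen O := (chartAt 𝔼 c).isOpen_inter_preimage_symm hUo
  have hK : IsCompact K := isCompact_chartAt_image hhs hhc
  have hKT : K ⊆ (chartAt 𝔼 c).target := chartAt_image_subset_target hhc
  have hKO : K ⊆ O := fun z hz => ⟨hKT hz, hhU ((chartAt_symm_mem_iff hhc (hKT hz)).2 hz)⟩
  have hv0 : ∀ x, 0 < Real.exp (u x) := fun x => Real.exp_pos _
  have hvc : ∀ p : ℝ, Continuous fun x => Real.exp (u x) ^ p := fun p =>
    (Real.continuous_exp.comp hu.continuous).rpow_const fun x => Or.inl (hv0 x).ne'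
  have hsymm : ContinuousOn (chartAt 𝔼 c).symm O :=
    (chartAt 𝔼 c).continuousOn_symm.mono inter_subset_left
  let r : 𝔼 → ℝ := fun z => ρ ((chartAt 𝔼 c).symm z)
  let Gc : Fin n → 𝔼 → ℝ := fun i z => inner ℝ (G ((chartAt 𝔼 c).symm z)) (coordVec c z i)
  let γ : Fin n → 𝔼 → ℝ := fun i z => chartCoord c (G ((chartAt 𝔼 c).symm z)) i
  let s : 𝔼 → ℝ := fun z => sqrtDetMetric c z
  have hGn' : ∀ᵐ z ∂volume.restrict O, ‖G ((chartAt 𝔼 c).symm z)‖ =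
      Real.exp (u ((chartAt 𝔼 c).symm z)) ^ (lam - mu) := by
    filter_upwards [ae_chart_of_ae_riemVolume hUo hGn c] with z hz
    exact norm_eq_of_norm_affineScale_eq_one hz
  obtain ⟨f, δ, D, L, hδ, hf1, hf2, hf3, hf4, hf5, hf6⟩ :=
    exists_contDiff_tendsto_of_weak_deriv_on hO hK hKO (r := r) (hρ.comp_continuousOn hsymm)
      (fun z hz => hρU _ hz.2) (G := Gc) (fun i => (hG c i).1)
      (b := fun i z => Real.exp (u ((chartAt 𝔼 c).symm z)) ^ (lam - mu) *
        Real.sqrt (Matrix.gram ℝ (coordVec c z) i i))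
      (fun i => ((hvc _).comp_continuousOn hsymm).mul
        (((contDiffOn_gram c i i).continuousOn.mono inter_subset_left).sqrt))
      (fun i => by
        filter_upwards [hGn'] with z hz
        rw [← hz]
        exact abs_inner_coordVec_le _ i)
      (fun i η h1 h2 h3 => (hG c i).2 η h1 h2 h3)
  have hf0 : ∀ k z, 0 < f k z := fun k z => hδ.trans_le (hf2 k z)
  have hfp : ∀ k (p : ℝ), ContDiff ℝ ∞ fun z => f k z ^ p := fun k p =>
    (hf1 k).rpow_const_of_ne fun z => (hf0 k z).ne'
  have hfd : ∀ k i, Continuous fun z => fderiv ℝ (f k) z (EuclideanSpace.single i (1 : ℝ)) :=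
    fun k i => ((hf1 k).continuous_fderiv (by simp)).clm_apply continuous_const
  have hder : ∀ k i z, fderiv ℝ (fun z => f k z ^ (α - 1)) z (EuclideanSpace.single i (1 : ℝ)) =
      (α - 1) * (f k z ^ (α - 2) * fderiv ℝ (f k) z (EuclideanSpace.single i (1 : ℝ))) := by
    intro k i z
    have h1 := (((hf1 k).differentiable (by simp) z).hasFDerivAt).rpow_const (p := α - 1)
      (Or.inl (hf0 k z).ne')
    rw [h1.fderiv, show α - 1 - 1 = α - 2 by ring]
    simp only [smul_apply, smul_eq_mul]
    ring
  have hB1 : ∀ k z, |f k z ^ (α - 1)| ≤ δ ^ (α - 1) + D ^ (α - 1) := fun k z => by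
    rw [abs_of_pos (Real.rpow_pos_of_pos (hf0 k z) _)]
    exact Real.rpow_le_add_of_mem_Icc hδ (hf2 k z) (hf3 k z) _
  have hB2 : ∀ i k z, |f k z ^ (α - 2) * fderiv ℝ (f k) z (EuclideanSpace.single i (1 : ℝ))| ≤
      (δ ^ (α - 2) + D ^ (α - 2)) * L := fun i k z => by
    rw [abs_mul, abs_of_pos (Real.rpow_pos_of_pos (hf0 k z) _)]
    have h1 := Real.rpow_le_add_of_mem_Icc hδ (hf2 k z) (hf3 k z) (α - 2)
    exact mul_le_mul h1 (hf5 k i z) (abs_nonneg _)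
      ((Real.rpow_pos_of_pos (hf0 k z) _).le.trans h1)
  have hsymmK : ContinuousOn (chartAt 𝔼 c).symm K := hsymm.mono hKO
  have hsc : ContinuousOn s K := (contDiffOn_sqrtDetMetric c).continuousOn.mono hKT
  have hhc' : ContinuousOn (fun z => h ((chartAt 𝔼 c).symm z)) K :=
    hh.continuous.comp_continuousOn hsymmK
  have hvK : ∀ p : ℝ, ContinuousOn (fun z => Real.exp (u ((chartAt 𝔼 c).symm z)) ^ p) K :=
    fun p => (hvc p).comp_continuousOn hsymmK
  have hrK : ContinuousOn r K := hρ.comp_continuousOn hsymmK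
  have hr0 : ∀ z ∈ K, 0 < r z := fun z hz => hρU _ (hKO hz).2
  let dh : Fin n → 𝔼 → ℝ := fun i z =>
    inner ℝ (riemGrad n h ((chartAt 𝔼 c).symm z)) (coordVec c z i)
  have hdh : ∀ i, ContinuousOn (dh i) K := fun i =>
    (contDiffOn_inner_riemGrad_coordVec hh c i).continuousOn.mono hKT
  have hγ : ∀ i, IntegrableOn (γ i) K := integrableOn_chartCoord hK hKT fun j =>
    (hG c j).1.integrableOn_compact_subset hKO hK
  let v : 𝔼 → ℝ → ℝ := fun z p => Real.exp (u ((chartAt 𝔼 c).symm z)) ^ p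
  -- The functions `g0`, `g1`, `g2` collect the integrable factors that do not depend on the
  -- approximation; the remaining factors are uniformly bounded.
  let g0 : 𝔼 → ℝ := fun z => s z * (C / r z * v z (lam - mu) * h ((chartAt 𝔼 c).symm z) *
    v z ((n + 1) * lam + mu))
  let g1 : Fin n → 𝔼 → ℝ := fun i z =>
    ((α - 1) * s z * v z (2 * mu + n * lam) * h ((chartAt 𝔼 c).symm z)) * γ i z
  let g2 : Fin n → 𝔼 → ℝ := fun i z => (s z * v z (2 * mu + n * lam) * dh i z) * γ i z
  have hg0 : IntegrableOn g0 K :=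
    (hsc.mul ((((continuousOn_const.div hrK fun z hz => (hr0 z hz).ne').mul (hvK _)).mul
      hhc').mul (hvK _))).integrableOn_compact hK
  have hg1 : ∀ i, IntegrableOn (g1 i) K := fun i =>
    (hγ i).continuousOn_mul (((continuousOn_const.mul hsc).mul (hvK _)).mul hhc') hK
  have hg2 : ∀ i, IntegrableOn (g2 i) K := fun i =>
    (hγ i).continuousOn_mul ((hsc.mul (hvK _)).mul (hdh i)) hK
  have hineq : ∀ k, ∫ z in K, f k z ^ (α - 1) * g0 z ≤
      -∑ i, ((∫ z in K, f k z ^ (α - 1) * g2 i z) + ∫ z in K,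
        (f k z ^ (α - 2) * fderiv ℝ (f k) z (EuclideanSpace.single i (1 : ℝ))) * g1 i z) := by
    intro k
    set ψ : M → ℝ := fun x => f k (chartAt 𝔼 c x) ^ (α - 1) * h x with hψdef
    have hψ : ContMDiff (𝓡 n) 𝓘(ℝ, ℝ) ∞ ψ := contMDiff_comp_chartAt_mul (hfp k (α - 1)) hh hhc
    have hψt : tsupport ψ ⊆ A := tsupport_mul_subset_right
    have hψs : HasCompactSupport ψ := hhs.mul_left
    have hψ0 : ∀ x, 0 ≤ ψ x := fun x =>
      mul_nonneg (Real.rpow_nonneg (hf0 k _).le _) (hh0 x)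
    have h1 := hlap ψ hψ hψs (hψt.trans hhU) hψ0
    rw [integral_mul_affineLaplacian hu lam mu hρ hG hψ hψs (hψt.trans hhU) (hψt.trans hhc),
      integral_riemVolume_image hhc fun x hx => by
        rw [show ψ x = 0 by rw [hψdef]; simp [image_eq_zero_of_notMem_tsupport hx]]
        ring,
      integral_riemVolume_image hhc fun x hx => by
        rw [riemGrad_eq_zero_of_notMem_tsupport fun h => hx (hψt h), inner_zero_left,
          zero_mul]] at h1
    have hL : ∫ z in K, f k z ^ (α - 1) * g0 z = ∫ z in K, sqrtDetMetric c z *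
        (C / ρ ((chartAt 𝔼 c).symm z) * Real.exp (u ((chartAt 𝔼 c).symm z)) ^ (lam - mu) *
          ψ ((chartAt 𝔼 c).symm z) *
            Real.exp (u ((chartAt 𝔼 c).symm z)) ^ ((n + 1) * lam + mu)) := by
      refine setIntegral_congr_fun hK.measurableSet fun z hz => ?_
      simp only [hψdef, (chartAt 𝔼 c).right_inv (hKT hz), g0, s, r, v]
      ring
    have hR : ∫ z in K, sqrtDetMetric c z * (inner ℝ (riemGrad n ψ ((chartAt 𝔼 c).symm z))
          (G ((chartAt 𝔼 c).symm z)) *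
            Real.exp (u ((chartAt 𝔼 c).symm z)) ^ (2 * mu + n * lam)) =
        ∑ i, ((∫ z in K, f k z ^ (α - 1) * g2 i z) + ∫ z in K,
          (f k z ^ (α - 2) * fderiv ℝ (f k) z (EuclideanSpace.single i (1 : ℝ))) * g1 i z) := by
      have hI1 : ∀ i, IntegrableOn (fun z => f k z ^ (α - 1) * g2 i z) K := fun i =>
        integrableOn_bounded_mul (hg2 i) (hfp k _).continuous (hB1 k)
      have hI2 : ∀ i, IntegrableOn (fun z => (f k z ^ (α - 2) *
          fderiv ℝ (f k) z (EuclideanSpace.single i (1 : ℝ))) * g1 i z) K := fun i =>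
        integrableOn_bounded_mul (hg1 i) ((hfp k _).continuous.mul (hfd k i)) (hB2 i k)
      rw [sum_integral_add_integral hI1 hI2]
      refine setIntegral_congr_fun hK.measurableSet fun z hz => ?_
      rw [inner_eq_sum_chartCoord (hKT hz), Finset.sum_mul, Finset.mul_sum]
      refine Finset.sum_congr rfl fun i _ => ?_
      rw [hψdef, inner_riemGrad_comp_chartAt_mul (hfp k (α - 1)) hh hhc (hKT hz) i, hder]
      simp only [g1, g2, s, v, γ, dh]
      ring
    rw [hL, ← hR]
    exact h1
  have hlim0 : Tendsto (fun k => ∫ z in K, f k z ^ (α - 1) * g0 z) atTop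
      (𝓝 (∫ z in K, r z ^ (α - 1) * g0 z)) :=
    tendsto_setIntegral_mul_of_bound hK.measurableSet hg0 (fun k => (hfp k _).continuous) hB1
      (Eventually.of_forall fun z hz => (hf4 z hz).rpow_const (Or.inl (hr0 z hz).ne'))
  have hlim2 : ∀ i, Tendsto (fun k => ∫ z in K, f k z ^ (α - 1) * g2 i z) atTop
      (𝓝 (∫ z in K, r z ^ (α - 1) * g2 i z)) := fun i =>
    tendsto_setIntegral_mul_of_bound hK.measurableSet (hg2 i) (fun k => (hfp k _).continuous) hB1
      (Eventually.of_forall fun z hz => (hf4 z hz).rpow_const (Or.inl (hr0 z hz).ne'))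
  have hlim1 : ∀ i, Tendsto (fun k => ∫ z in K, (f k z ^ (α - 2) *
      fderiv ℝ (f k) z (EuclideanSpace.single i (1 : ℝ))) * g1 i z) atTop
      (𝓝 (∫ z in K, (r z ^ (α - 2) * Gc i z) * g1 i z)) := fun i =>
    tendsto_setIntegral_mul_of_bound hK.measurableSet (hg1 i)
      (fun k => (hfp k _).continuous.mul (hfd k i)) (hB2 i) (by
        filter_upwards [hf6 i] with z hz hzK
        exact ((hf4 z hzK).rpow_const (Or.inl (hr0 z hzK).ne')).mul (hz hzK))
  have hmain := le_of_tendsto_of_tendsto' hlim0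
    (tendsto_finsetSum _ fun i _ => (hlim2 i).add (hlim1 i)).neg hineq
  set I : ℝ := ∫ x, ρ x ^ (α - 2) * h x * Real.exp (u x) ^ ((n + 2) * lam) ∂(riemVolume n M) with hI
  set J : ℝ := ∫ x, ρ x ^ (α - 1) * Real.exp (u x) ^ (2 * mu + n * lam) *
    inner ℝ (riemGrad n h x) (G x) ∂(riemVolume n M) with hJ
  let p : 𝔼 → ℝ := fun z => s z * (r z ^ (α - 2) * h ((chartAt 𝔼 c).symm z) * v z ((n + 2) * lam))
  let q : 𝔼 → ℝ := fun z => s z * (r z ^ (α - 1) * v z (2 * mu + n * lam) *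
    inner ℝ (riemGrad n h ((chartAt 𝔼 c).symm z)) (G ((chartAt 𝔼 c).symm z)))
  have hIp : I = ∫ z in K, p z := integral_riemVolume_image hhc fun x hx => by
    rw [image_eq_zero_of_notMem_tsupport hx, mul_zero, zero_mul]
  have hJq : J = ∫ z in K, q z := integral_riemVolume_image hhc fun x hx => by
    rw [riemGrad_eq_zero_of_notMem_tsupport hx, inner_zero_left, mul_zero]
  have hrp : ∀ a : ℝ, ContinuousOn (fun z => r z ^ a) K := fun a =>
    hrK.rpow_const fun z hz => Or.inl (hr0 z hz).ne'
  have hp : IntegrableOn p K :=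
    (hsc.mul (((hrp _).mul hhc').mul (hvK _))).integrableOn_compact hK
  have hq : IntegrableOn q K := by
    refine (integrable_riemVolume_iff_image hhc fun x hx => ?_).1
      (integrable_mul_inner_riemGrad hG hh hhs hhU hhc
        (w := fun x => ρ x ^ (α - 1) * Real.exp (u x) ^ (2 * mu + n * lam)) ?_)
    · rw [riemGrad_eq_zero_of_notMem_tsupport hx, inner_zero_left, mul_zero]
    · exact (hρ.continuousOn.rpow_const fun x hx => Or.inl (hρU x hx).ne').mul
        (hvc _).continuousOn
  have hleft : ∫ z in K, r z ^ (α - 1) * g0 z = C * I := by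
    rw [hIp, ← integral_const_mul]
    refine setIntegral_congr_fun hK.measurableSet fun z hz => ?_
    have h1 : r z ^ (α - 1) = r z ^ (α - 2) * r z := by
      rw [← Real.rpow_add_one (hr0 z hz).ne']
      ring_nf
    have h2 : v z ((n + 2) * lam) = v z (lam - mu) * v z ((n + 1) * lam + mu) := by
      simp only [v]
      rw [← Real.rpow_add (hv0 _)]
      ring_nf
    simp only [g0, p, h1, h2]
    have h3 := (hr0 z hz).ne'
    field_simp
  -- The limit inherits the uniform bound of the approximants, which makes its product with `g1`
  -- integrable.
  have hGL : ∀ i, ∀ᵐ z ∂volume.restrict K, ‖r z ^ (α - 2) * Gc i z‖ ≤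
      (δ ^ (α - 2) + D ^ (α - 2)) * L := by
    intro i
    rw [ae_restrict_iff' hK.measurableSet]
    filter_upwards [hf6 i] with z hz hzK
    exact le_of_tendsto' (((hf4 z hzK).rpow_const (Or.inl (hr0 z hzK).ne')).mul (hz hzK)).norm
      fun k => hB2 i k z
  have hright : ∑ i, ((∫ z in K, r z ^ (α - 1) * g2 i z) +
      ∫ z in K, (r z ^ (α - 2) * Gc i z) * g1 i z) = J + (α - 1) * I := by
    have hI1 : ∀ i, IntegrableOn (fun z => r z ^ (α - 1) * g2 i z) K := fun i =>
      (hg2 i).continuousOn_mul (hrp _) hK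
    have hI2 : ∀ i, IntegrableOn (fun z => (r z ^ (α - 2) * Gc i z) * g1 i z) K := fun i =>
      Integrable.bdd_mul (hg1 i) (((hrp _).aestronglyMeasurable hK.measurableSet).mul
        ((hG c i).1.integrableOn_compact_subset hKO hK).1) (hGL i)
    rw [sum_integral_add_integral hI1 hI2, hIp, hJq, ← integral_const_mul]
    refine Eq.trans ?_ (integral_add hq (hp.const_mul (α - 1)))
    refine setIntegral_congr_ae hK.measurableSet ?_
    filter_upwards [(ae_restrict_iff' hO.measurableSet).1 hGn'] with z hz hzK
    -- Here `|∇ᴰρ| = 1` enters as an equality: `|G|² = V ^ (2(λ - μ))`, and `2μ + nλ + 2(λ - μ) = (n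
    -- + 2)λ`.
    have h1 : v z (2 * mu + n * lam) * ∑ i, Gc i z * γ i z = v z ((n + 2) * lam) := by
      have h2 : ∑ i, Gc i z * γ i z = v z (lam - mu) * v z (lam - mu) := by
        rw [← inner_eq_sum_chartCoord (hKT hzK), real_inner_self_eq_norm_mul_norm, hz (hKO hzK)]
      rw [h2]
      simp only [v]
      rw [← Real.rpow_add (hv0 _), ← Real.rpow_add (hv0 _)]
      ring_nf
    simp only [p, q, ← h1]
    rw [inner_eq_sum_chartCoord (hKT hzK)]
    simp only [Finset.mul_sum, ← Finset.sum_add_distrib]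
    refine Finset.sum_congr rfl fun i _ => ?_
    simp only [g1, g2, dh, γ]
    ring
  rw [hleft, hright] at hmain
  linarith

end LocalHardyInequality

/-- By local finiteness, only finitely many members of a partition of unity subordinate to the
charts meet a compact set. -/
theorem exists_finset_partition {n : ℕ} {M : Type*} [TopologicalSpace M] [T2Space M]
    [SecondCountableTopology M] [ChartedSpace (EuclideanSpace ℝ (Fin n)) M]
    [IsManifold (𝓡 n) ∞ M] {A : Set M} (hA : IsCompact A) :
    ∃ (S : Finset M) (χ : M → M → ℝ), (∀ c, ContMDiff (𝓡 n) 𝓘(ℝ, ℝ) ∞ (χ c)) ∧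
      (∀ c x, 0 ≤ χ c x) ∧ (∀ c, tsupport (χ c) ⊆ (chartAt (EuclideanSpace ℝ (Fin n)) c).source) ∧
      ∀ x ∈ A, ∑ c ∈ S, χ c x = 1 := by
  have : LocallyCompactSpace M := ChartedSpace.locallyCompactSpace (EuclideanSpace ℝ (Fin n)) M
  obtain ⟨χ, hχ⟩ := SmoothPartitionOfUnity.exists_isSubordinate_chartAt_source (𝓡 n) M
  have hfin := χ.locallyFinite.finite_nonempty_inter_compact hA
  refine ⟨hfin.toFinset, fun c => χ c, fun c => (χ c).contMDiff, fun c x => χ.nonneg c x,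
    fun c => hχ c, fun x hx => ?_⟩
  rw [← χ.sum_eq_one (mem_univ x)]
  refine (finsum_eq_sum_of_support_subset _ fun c hc => ?_).symm
  simp only [Finite.coe_toFinset, mem_ofPred_eq]
  exact ⟨x, hc, hx⟩

/-! ### Gradient rules and integrability of continuous integrands -/

section ContinuousIntegrands

variable {n : ℕ} {M : Type*} [TopologicalSpace M] [ChartedSpace (EuclideanSpace ℝ (Fin n)) M]
  [RiemannianBundle (fun x : M => TangentSpace (𝓡 n) x)]

local notation "𝔼" => EuclideanSpace ℝ (Fin n)

theorem inner_riemGrad_zero {x : M} (v : TangentSpace (𝓡 n) x) :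
    inner ℝ (riemGrad n (0 : M → ℝ) x) v = 0 := by
  rw [inner_riemGrad, show mfderiv (𝓡 n) 𝓘(ℝ, ℝ) (0 : M → ℝ) x = 0 from mfderiv_const]
  rfl

theorem inner_riemGrad_add {f g : M → ℝ} {x : M} (hf : MDifferentiableAt (𝓡 n) 𝓘(ℝ, ℝ) f x)
    (hg : MDifferentiableAt (𝓡 n) 𝓘(ℝ, ℝ) g x) (v : TangentSpace (𝓡 n) x) :
    inner ℝ (riemGrad n (f + g) x) v = inner ℝ (riemGrad n f x) v + inner ℝ (riemGrad n g x) v := by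
  simp only [inner_riemGrad]
  rw [(hf.hasMFDerivAt.add hg.hasMFDerivAt).mfderiv]
  rfl

theorem inner_riemGrad_finsetSum {ι : Type*} (S : Finset ι) {h : ι → M → ℝ} {x : M}
    (hh : ∀ i ∈ S, MDifferentiableAt (𝓡 n) 𝓘(ℝ, ℝ) (h i) x) (v : TangentSpace (𝓡 n) x) :
    inner ℝ (riemGrad n (∑ i ∈ S, h i) x) v = ∑ i ∈ S, inner ℝ (riemGrad n (h i) x) v := by
  classical
  suffices H : MDifferentiableAt (𝓡 n) 𝓘(ℝ, ℝ) (∑ i ∈ S, h i) x ∧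
      inner ℝ (riemGrad n (∑ i ∈ S, h i) x) v = ∑ i ∈ S, inner ℝ (riemGrad n (h i) x) v from H.2
  induction S using Finset.induction_on with
  | empty => exact ⟨mdifferentiableAt_const (c := (0 : ℝ)), inner_riemGrad_zero v⟩
  | insert a T ha ih =>
    have h1 := hh a (Finset.mem_insert_self a T)
    obtain ⟨h2, h3⟩ := ih fun i hi => hh i (Finset.mem_insert_of_mem hi)
    rw [Finset.sum_insert ha, Finset.sum_insert ha]
    exact ⟨h1.add h2, by rw [inner_riemGrad_add h1 h2, h3]⟩

theorem inner_riemGrad_mul_self {φ : M → ℝ} {x : M} (hφ : MDifferentiableAt (𝓡 n) 𝓘(ℝ, ℝ) φ x)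
    (v : TangentSpace (𝓡 n) x) :
    inner ℝ (riemGrad n (φ * φ) x) v = 2 * φ x * inner ℝ (riemGrad n φ x) v := by
  simp only [inner_riemGrad]
  rw [(hφ.hasMFDerivAt.mul hφ.hasMFDerivAt).mfderiv]
  have h1 : ∀ L : TangentSpace (𝓡 n) x →L[ℝ] ℝ, (φ x • L + φ x • L) v = 2 * φ x * L v := by
    intro L
    simp only [add_apply, smul_apply, smul_eq_mul]
    ring
  exact h1 _

variable [IsManifold (𝓡 n) ∞ M]
  [IsContMDiffRiemannianBundle (𝓡 n) ∞ (EuclideanSpace ℝ (Fin n))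
    (fun x : M => TangentSpace (𝓡 n) x)]

theorem continuous_norm_riemGrad_sq {φ : M → ℝ} (hφ : ContMDiff (𝓡 n) 𝓘(ℝ, ℝ) ∞ φ) :
    Continuous fun x => ‖riemGrad n φ x‖ ^ 2 := by
  rw [continuous_iff_continuousAt]
  intro c
  have hc : (chartAt 𝔼 c).source ∈ nhds c := (chartAt 𝔼 c).open_source.mem_nhds (mem_chart_source 𝔼 c)
  have h1 : ContinuousOn (fun z => ∑ i, inner ℝ (riemGrad n φ ((chartAt 𝔼 c).symm z)) (coordVec c z i) *
      chartCoord c (riemGrad n φ ((chartAt 𝔼 c).symm z)) i) (chartAt 𝔼 c).target :=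
    continuousOn_finsetSum _ fun i _ => (contDiffOn_inner_riemGrad_coordVec hφ c i).continuousOn.mul
      (contDiffOn_chartCoord_riemGrad hφ c i).continuousOn
  have h2 : ContinuousOn (fun x => ‖riemGrad n φ x‖ ^ 2) (chartAt 𝔼 c).source := by
    refine (h1.comp (chartAt 𝔼 c).continuousOn fun x hx => (chartAt 𝔼 c).map_source hx).congr
      fun x hx => ?_
    simp only [Function.comp_apply]
    rw [← inner_eq_sum_chartCoord ((chartAt 𝔼 c).map_source hx), (chartAt 𝔼 c).left_inv hx,
      real_inner_self_eq_norm_sq]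
  exact h2.continuousAt hc

variable [MeasurableSpace M] [BorelSpace M]

/-- A compact neighbourhood inside a chart has finite volume because `√(det g)` is continuous on its
compact image. -/
theorem isFiniteMeasureOnCompacts_riemVolume [T2Space M] :
    IsFiniteMeasureOnCompacts (riemVolume n M) := by
  have : LocallyCompactSpace M := ChartedSpace.locallyCompactSpace 𝔼 M
  have : IsLocallyFiniteMeasure (riemVolume n M) := by
    refine ⟨fun c => ?_⟩
    obtain ⟨N, hNc, hNs, hN⟩ := local_compact_nhds
      ((chartAt 𝔼 c).open_source.mem_nhds (mem_chart_source 𝔼 c))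
    refine ⟨N, hNc, ?_⟩
    have hint : Integrable (N.indicator fun _ => (1 : ℝ)) (riemVolume n M) := by
      rw [integrable_riemVolume_iff_image hNs fun x hx => indicator_of_notMem hx _]
      have hK : IsCompact (chartAt 𝔼 c '' N) := isCompact_chartAt_image hN hNs
      refine IntegrableOn.congr_fun (((contDiffOn_sqrtDetMetric c).continuousOn.mono
        (chartAt_image_subset_target hNs)).integrableOn_compact hK) (fun z hz => ?_) hK.measurableSet
      rw [indicator_of_mem ((chartAt_symm_mem_iff hNs (chartAt_image_subset_target hNs hz)).2 hz),
        mul_one]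
    rw [integrable_indicator_iff hN.measurableSet] at hint
    simpa [integrableOn_const_iff] using hint
  infer_instance

/-- A function that is continuous on an open set is integrable if it vanishes off a compact
subset. -/
theorem integrable_riemVolume_of_continuousOn [T2Space M] {f : M → ℝ} {U A : Set M}
    (hA : IsCompact A) (hAU : A ⊆ U) (hf : ContinuousOn f U) (h0 : ∀ x, x ∉ A → f x = 0) :
    Integrable f (riemVolume n M) := by
  have := isFiniteMeasureOnCompacts_riemVolume (n := n) (M := M)
  exact (integrableOn_iff_integrable_of_support_subset (Function.support_subset_iff'.2 h0)).1
    ((hf.mono hAU).integrableOn_compact hA)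

end ContinuousIntegrands

/-! ### Gluing the chart inequalities -/

section GlobalHardy

variable {n : ℕ} {M : Type*} [TopologicalSpace M] [T2Space M] [SecondCountableTopology M]
  [ChartedSpace (EuclideanSpace ℝ (Fin n)) M] [IsManifold (𝓡 n) ∞ M]
  [RiemannianBundle (fun x : M => TangentSpace (𝓡 n) x)]
  [IsContMDiffRiemannianBundle (𝓡 n) ∞ (EuclideanSpace ℝ (Fin n))
    (fun x : M => TangentSpace (𝓡 n) x)]
  [MeasurableSpace M] [BorelSpace M]

/-- The weak inequality for the drifted divergence of `ρ ^ (α - 1) ∇ρ`, tested against `φ ^ 2`. -/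
theorem integral_sq_le_neg_integral_inner {u : M → ℝ} (hu : ContMDiff (𝓡 n) 𝓘(ℝ, ℝ) ∞ u)
    {lam mu C α : ℝ} {ρ : M → ℝ} (hρ : Continuous ρ) (hρ_nonneg : ∀ x, 0 ≤ ρ x)
    {G : (x : M) → TangentSpace (𝓡 n) x} (hG : IsWeakGradOn (ρ ⁻¹' {0})ᶜ ρ G)
    (hGn : ∀ᵐ x ∂(riemVolume n M).restrict (ρ ⁻¹' {0})ᶜ, ‖affineScale lam mu u G x‖ = 1)
    (hlap : WeakAffineLaplacianGeOn n lam mu u (ρ ⁻¹' {0})ᶜ ρ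
      (fun x => C / ρ x * Real.exp (u x) ^ (lam - mu)))
    {φ : M → ℝ} (hφ : ContMDiff (𝓡 n) 𝓘(ℝ, ℝ) ∞ φ) (hφs : HasCompactSupport φ)
    (hφU : tsupport φ ⊆ (ρ ⁻¹' {0})ᶜ) :
    Integrable (fun x => ρ x ^ (α - 1) * Real.exp (u x) ^ (2 * mu + n * lam) *
      (2 * φ x * inner ℝ (riemGrad n φ x) (G x))) (riemVolume n M) ∧
    (C + α - 1) * ∫ x, ρ x ^ (α - 2) * φ x ^ 2 * Real.exp (u x) ^ ((n + 2) * lam)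
        ∂(riemVolume n M) ≤
      -∫ x, ρ x ^ (α - 1) * Real.exp (u x) ^ (2 * mu + n * lam) *
        (2 * φ x * inner ℝ (riemGrad n φ x) (G x)) ∂(riemVolume n M) := by
  have hρU : ∀ x ∈ (ρ ⁻¹' {0})ᶜ, ρ x ≠ 0 := fun x hx => hx
  have hvc : ∀ p : ℝ, Continuous fun x => Real.exp (u x) ^ p := fun p =>
    (Real.continuous_exp.comp hu.continuous).rpow_const fun x => Or.inl (Real.exp_pos _).ne'
  have hρc : ∀ p : ℝ, ContinuousOn (fun x => ρ x ^ p) (ρ ⁻¹' {0})ᶜ := fun p =>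
    hρ.continuousOn.rpow_const fun x hx => Or.inl (hρU x hx)
  obtain ⟨S, χ, hχ, hχ0, hχs, hχ1⟩ := exists_finset_partition (n := n) hφs.isCompact
  -- The local inequality is linear in its test function and requires it to be nonnegative, so `φ²`
  -- itself is split. On summation the gradients of the cutoffs recombine to `∇(φ²)` and leave no
  -- error term.
  set h : M → M → ℝ := fun c => χ c * (φ * φ) with hdef
  have hh : ∀ c, ContMDiff (𝓡 n) 𝓘(ℝ, ℝ) ∞ (h c) := fun c => (hχ c).mul (hφ.mul hφ)
  have hh0 : ∀ c x, 0 ≤ h c x := fun c x => mul_nonneg (hχ0 c x) (mul_self_nonneg _)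
  have hhφ : ∀ c, tsupport (h c) ⊆ tsupport φ := fun c =>
    (tsupport_mul_subset_right).trans tsupport_mul_subset_left
  have hhs : ∀ c, HasCompactSupport (h c) := fun c =>
    hφs.of_isClosed_subset (isClosed_tsupport _) (hhφ c)
  have hhc : ∀ c, tsupport (h c) ⊆ (chartAt (EuclideanSpace ℝ (Fin n)) c).source := fun c =>
    (tsupport_mul_subset_left).trans (hχs c)
  have hsum : ∑ c ∈ S, h c = φ * φ := by
    simp only [hdef, ← Finset.sum_mul]
    ext x
    rw [Pi.mul_apply]
    by_cases hx : x ∈ tsupport φ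
    · rw [Finset.sum_apply, hχ1 x hx, one_mul]
    · simp [image_eq_zero_of_notMem_tsupport hx]
  have hint1 : ∀ c ∈ S, Integrable (fun x => ρ x ^ (α - 2) * h c x *
      Real.exp (u x) ^ ((n + 2) * lam)) (riemVolume n M) := fun c _ =>
    integrable_riemVolume_of_continuousOn hφs hφU
      (((hρc _).mul (hh c).continuous.continuousOn).mul (hvc _).continuousOn) fun x hx => by
        simp [hdef, image_eq_zero_of_notMem_tsupport hx]
  have hint2 : ∀ c ∈ S, Integrable (fun x => ρ x ^ (α - 1) * Real.exp (u x) ^ (2 * mu + n * lam) *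
      inner ℝ (riemGrad n (h c) x) (G x)) (riemVolume n M) := fun c _ =>
    integrable_mul_inner_riemGrad hG (hh c) (hhs c) ((hhφ c).trans hφU) (hhc c)
      ((hρc _).mul (hvc _).continuousOn)
  have e1 : ∀ x, ρ x ^ (α - 2) * φ x ^ 2 * Real.exp (u x) ^ ((n + 2) * lam) =
      ∑ c ∈ S, ρ x ^ (α - 2) * h c x * Real.exp (u x) ^ ((n + 2) * lam) := fun x => by
    rw [← Finset.sum_mul, ← Finset.mul_sum, ← Finset.sum_apply, hsum, Pi.mul_apply, sq]
  have e2 : ∀ x, ρ x ^ (α - 1) * Real.exp (u x) ^ (2 * mu + n * lam) *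
      (2 * φ x * inner ℝ (riemGrad n φ x) (G x)) =
      ∑ c ∈ S, ρ x ^ (α - 1) * Real.exp (u x) ^ (2 * mu + n * lam) *
        inner ℝ (riemGrad n (h c) x) (G x) := fun x => by
    rw [← Finset.mul_sum, ← inner_riemGrad_finsetSum S fun c _ => (hh c).mdifferentiableAt (by simp),
      hsum, inner_riemGrad_mul_self (hφ.mdifferentiableAt (by simp))]
  simp only [e1, e2]
  refine ⟨integrable_finsetSum _ hint2, ?_⟩
  rw [integral_finsetSum _ hint1, integral_finsetSum _ hint2, Finset.mul_sum, ← Finset.sum_neg_distrib]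
  exact Finset.sum_le_sum fun c _ => integral_le_neg_integral_inner hu hρ hρ_nonneg hG hGn hlap
    (hh c) (hhs c) ((hhφ c).trans hφU) (hh0 c) (hhc c)

end GlobalHardy

/-! ### The Hardy inequality -/

theorem mainTheorem10 (n : ℕ) (M : Type*) [TopologicalSpace M] [T2Space M]
    [SecondCountableTopology M] [ChartedSpace (EuclideanSpace ℝ (Fin n)) M]
    [IsManifold (𝓡 n) ∞ M] [MeasurableSpace M] [BorelSpace M]
    [RiemannianBundle (fun x : M => TangentSpace (𝓡 n) x)]
    [IsContMDiffRiemannianBundle (𝓡 n) ∞ (EuclideanSpace ℝ (Fin n))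
      (fun x : M => TangentSpace (𝓡 n) x)]
    (u : M → ℝ) (hu : ContMDiff (𝓡 n) 𝓘(ℝ, ℝ) ∞ u)
    (lam mu tau C α : ℝ) (htau : tau = (n + 1) * lam + mu)
    (hC : 1 < C) (hCα : 0 < C + α - 1)
    (ρ : M → ℝ) (hρ : Continuous ρ) (hρ_nonneg : ∀ x, 0 ≤ ρ x)
    (hρ_grad : WeakAffineGradNormEqOneOn n lam mu u (ρ ⁻¹' {0})ᶜ ρ)
    (hρ_lap : WeakAffineLaplacianGeOn n lam mu u (ρ ⁻¹' {0})ᶜ ρ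
      (fun x => C / ρ x * Real.exp (u x) ^ (lam - mu)))
    (φ : M → ℝ) (hφ : ContMDiff (𝓡 n) 𝓘(ℝ, ℝ) ∞ φ) (hφ_supp : HasCompactSupport φ)
    (hφ_zero : tsupport φ ⊆ (ρ ⁻¹' {0})ᶜ) :
    Integrable (fun x => ρ x ^ α * ‖affineGrad n lam mu u φ x‖ ^ 2 *
      Real.exp (u x) ^ (tau + lam - mu)) (riemVolume n M) ∧
    Integrable (fun x => ρ x ^ (α - 2) * φ x ^ 2 *
      Real.exp (u x) ^ (tau + lam - mu)) (riemVolume n M) ∧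
    ∫ x, ρ x ^ α * ‖affineGrad n lam mu u φ x‖ ^ 2 *
        Real.exp (u x) ^ (tau + lam - mu) ∂(riemVolume n M) ≥
      ((C + α - 1) / 2) ^ 2 *
        ∫ x, ρ x ^ (α - 2) * φ x ^ 2 *
          Real.exp (u x) ^ (tau + lam - mu) ∂(riemVolume n M) := by
  obtain ⟨G, hG, hGn⟩ := hρ_grad
  have hA : 0 < C + α - 1 := hCα
  have hU : MeasurableSet (ρ ⁻¹' {0})ᶜ := (isClosed_singleton.preimage hρ).isOpen_compl.measurableSet
  have hρU : ∀ x ∈ (ρ ⁻¹' {0})ᶜ, 0 < ρ x := fun x hx => (hρ_nonneg x).lt_of_ne' hx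
  have hv0 : ∀ x, 0 < Real.exp (u x) := fun x => Real.exp_pos _
  have hvc : ∀ p : ℝ, Continuous fun x => Real.exp (u x) ^ p := fun p =>
    (Real.continuous_exp.comp hu.continuous).rpow_const fun x => Or.inl (hv0 x).ne'
  have hρc : ∀ p : ℝ, ContinuousOn (fun x => ρ x ^ p) (ρ ⁻¹' {0})ᶜ := fun p =>
    hρ.continuousOn.rpow_const fun x hx => Or.inl (hρU x hx).ne'
  have e1 : ∀ x, ρ x ^ α * ‖affineGrad n lam mu u φ x‖ ^ 2 * Real.exp (u x) ^ (tau + lam - mu) =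
      ρ x ^ α * ‖riemGrad n φ x‖ ^ 2 * Real.exp (u x) ^ (2 * mu + n * lam) := fun x => by
    rw [affineGrad, affineScale, norm_smul, Real.norm_of_nonneg (Real.rpow_nonneg (hv0 x).le _),
      show (2 * mu + n * lam : ℝ) = (mu - lam) + (mu - lam) + (tau + lam - mu) by rw [htau]; ring,
      Real.rpow_add (hv0 x), Real.rpow_add (hv0 x)]
    ring
  have e2 : tau + lam - mu = (n + 2) * lam := by rw [htau]; ring
  have hint1 : Integrable (fun x => ρ x ^ α * ‖riemGrad n φ x‖ ^ 2 *
      Real.exp (u x) ^ (2 * mu + n * lam)) (riemVolume n M) :=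
    integrable_riemVolume_of_continuousOn hφ_supp hφ_zero
      (((hρc _).mul (continuous_norm_riemGrad_sq hφ).continuousOn).mul (hvc _).continuousOn)
      fun x hx => by simp [riemGrad_eq_zero_of_notMem_tsupport hx]
  have hint2 : Integrable (fun x => ρ x ^ (α - 2) * φ x ^ 2 *
      Real.exp (u x) ^ ((n + 2) * lam)) (riemVolume n M) :=
    integrable_riemVolume_of_continuousOn hφ_supp hφ_zero
      (((hρc _).mul (hφ.continuous.pow 2).continuousOn).mul (hvc _).continuousOn)
      fun x hx => by simp [image_eq_zero_of_notMem_tsupport hx]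
  obtain ⟨hint3, hle⟩ := integral_sq_le_neg_integral_inner hu hρ hρ_nonneg hG hGn hρ_lap hφ
    hφ_supp hφ_zero (α := α)
  simp only [e1]
  simp only [e2]
  refine ⟨hint1, hint2, ?_⟩
  -- Cauchy–Schwarz and Young with a weight `ε`: from `A J ≤ ε J + I / ε` one gets `ε (A - ε) J ≤
  -- I`, and `ε = A / 2` maximizes the factor, giving `(A / 2)²`. The difference in Young's
  -- inequality is the square completed at the end of the computation.
  have hpt : ∀ᵐ x ∂(riemVolume n M), -(ρ x ^ (α - 1) * Real.exp (u x) ^ (2 * mu + n * lam) *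
      (2 * φ x * inner ℝ (riemGrad n φ x) (G x))) ≤
      (C + α - 1) / 2 * (ρ x ^ (α - 2) * φ x ^ 2 * Real.exp (u x) ^ ((n + 2) * lam)) +
      2 / (C + α - 1) * (ρ x ^ α * ‖riemGrad n φ x‖ ^ 2 *
        Real.exp (u x) ^ (2 * mu + n * lam)) := by
    filter_upwards [(ae_restrict_iff' hU).1 hGn] with x hx
    by_cases hxφ : x ∈ tsupport φ
    · have hxU := hφ_zero hxφ
      have hr := hρU x hxU
      have hn := norm_eq_of_norm_affineScale_eq_one (hx hxU)
      have hcs : -(φ x * inner ℝ (riemGrad n φ x) (G x)) ≤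
          |φ x| * (‖riemGrad n φ x‖ * Real.exp (u x) ^ (lam - mu)) := by
        refine (neg_le_abs _).trans ?_
        rw [abs_mul, ← hn]
        exact mul_le_mul_of_nonneg_left (abs_real_inner_le_norm _ _) (abs_nonneg _)
      have hr1 : ρ x ^ (α - 1) = ρ x ^ (α - 2) * ρ x := by
        rw [← Real.rpow_add_one hr.ne']
        ring_nf
      have hr2 : ρ x ^ α = ρ x ^ (α - 2) * ρ x ^ 2 := by
        -- The square is rewritten as a real power so that the exponents can be added; positivity of
        -- `ρ x` is needed because `α - 2` may be negative.
        rw [← Real.rpow_natCast, ← Real.rpow_add hr]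
        simp
      have hv2 : Real.exp (u x) ^ ((n + 2) * lam) =
          Real.exp (u x) ^ (2 * mu + n * lam) * (Real.exp (u x) ^ (lam - mu)) ^ 2 := by
        rw [sq, ← Real.rpow_add (hv0 x), ← Real.rpow_add (hv0 x)]
        ring_nf
      have hR : 0 < ρ x ^ (α - 2) := Real.rpow_pos_of_pos hr _
      have hW : 0 < Real.exp (u x) ^ (2 * mu + n * lam) := Real.rpow_pos_of_pos (hv0 x) _
      rw [hr1, hr2, hv2, ← sq_abs (φ x)]
      generalize C + α - 1 = A at hA ⊢
      generalize ρ x ^ (α - 2) = R at hR ⊢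
      generalize Real.exp (u x) ^ (2 * mu + n * lam) = W at hW ⊢
      generalize Real.exp (u x) ^ (lam - mu) = t at hcs ⊢
      generalize ‖riemGrad n φ x‖ = g at hcs ⊢
      calc -(R * ρ x * W * (2 * φ x * inner ℝ (riemGrad n φ x) (G x)))
          = 2 * (R * ρ x * W) * -(φ x * inner ℝ (riemGrad n φ x) (G x)) := by ring
        _ ≤ 2 * (R * ρ x * W) * (|φ x| * (g * t)) := by gcongr
        _ ≤ 2 * (R * ρ x * W) * (|φ x| * (g * t)) +
            2 / A * (R * W) * (A / 2 * |φ x| * t - ρ x * g) ^ 2 :=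
          le_add_of_nonneg_right (by positivity)
        _ = _ := by
          field_simp
          ring
    · rw [image_eq_zero_of_notMem_tsupport hxφ, riemGrad_eq_zero_of_notMem_tsupport hxφ]
      simp
  have hfin := integral_mono_ae hint3.neg ((hint2.const_mul _).add (hint1.const_mul _)) hpt
  rw [integral_neg', integral_add' (hint2.const_mul _) (hint1.const_mul _), integral_const_mul,
    integral_const_mul] at hfin
  have h := hle.trans hfin
  generalize C + α - 1 = A at hA h ⊢
  generalize ∫ x, ρ x ^ (α - 2) * φ x ^ 2 * Real.exp (u x) ^ ((n + 2) * lam) ∂(riemVolume n M) = J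
    at h ⊢
  generalize ∫ x, ρ x ^ α * ‖riemGrad n φ x‖ ^ 2 * Real.exp (u x) ^ (2 * mu + n * lam)
    ∂(riemVolume n M) = I at h ⊢
  calc (A / 2) ^ 2 * J = A / 2 * (A * J - A / 2 * J) := by ring
    _ ≤ A / 2 * (2 / A * I) := by
      gcongr
      linarith
    _ = I := by field_simp
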